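/- Let $M$ be a compact Riemann surface, $\omega$ a smooth positive real $2$-form on $M$ (locally $\omega = i e^{2\sigma}h^2\,dz\wedge d\bar z$), and $L\to M$ a smooth complex line bundle with a smooth Hermitian metric $H$. Let $\mathcal C$ be the space of triples $p=(A,\Psi,\Phi)$ where $A$ is a smooth unitary connection on $L$, $\Psi=(\psi_1,\bar\psi_2)$ is a smooth section of $L\oplus L$, and $\Phi=\phi\,dz-\bar\phi\,d\bar z\in\Omega^1(M,i\mathbb R)$. Let $\mathcal S\subset\mathcal C$ be the set of solutions of $$F(A)=\tfrac{i}{2}\big(|\psi_1|_H^2+|\psi_2|_H^2\big)\,\omega,\qquad \partial\Phi^{0,1}=0,$$ $$(\bar\partial+A^{0,1})\psi_1+\tfrac12\bar\phi\,d\bar z\,\bar\psi_2=0,\qquad -\tfrac12\bar\phi\,d\bar z\,\psi_1+(\bar\partial+A^{0,1})\bar\psi_2=0.$$ A tangent vector of $\mathcal C$ is a smooth triple $X=(\alpha,\beta,\gamma)$ with $\alpha,\gamma\in\Omega^1(M,i\mathbb R)$ and $\beta=(\beta_1,\bar\beta_2)\in\Gamma(M,L\oplus L)$. For $p\in\mathcal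 S$, let $T_p\mathcal S$ be the space of those $X$ that satisfy the linearized equations, i.e. for which the derivative at $t=0$ of each of the equations along $t\mapsto p+tX$ vanishes. Smooth maps $u:M\to U(1)$ act on $\mathcal C$ by $u\cdot(A,\Psi,\Phi)=(A+u^{-1}du,\,u^{-1}\Psi,\,\Phi)$, and the tangent space $T_pO_p$ of the gauge orbit through $p$ consists of the velocities at $t=0$ of the curves $e^{t\zeta}\cdot p$ with $\zeta\in C^\infty(M,i\mathbb R)$, i.e. of the vectors $(d\zeta,-\zeta\Psi,0)$. Let $*$ act on $1$-forms by $-i$ on type $(1,0)$ and by $i$ on type $(0,1)$, let $\mathcal I(\alpha,\beta,\gamma)=(*\alpha,i\beta,*\gamma)$, and for $X=(\alpha_1,\beta,\gamma_1)$ and $Y=(\alpha_2,\eta,\gamma_2)$, where $\eta=(\eta_1,\bar\eta_2)$, put $$g(X,Y)=\int_M *\alpha_1\wedge\alpha_2+\int_M \mathrm{Re}\,\big(\langle\beta_1,\eta_1\rangle_H+\langle\bar\beta_2,\bar\eta_2\rangle_H\big)\,\omega+\int_M *\gamma_1\wedge\gamma_2 .$$ Let $p\in\mathcal S$ and $X\in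 T_p\mathcal S$. Then $\mathcal I X\in T_p\mathcal S$ if and only if $g(X,Y)=0$ for every $Y\in T_pO_p$. -/

import Mathlib

open Bundle Set
open scoped Manifold ContDiff Topology

noncomputable section

namespace ReducedSW

/-! ### The underlying real structures -/

/-- A complex manifold of dimension one is a smooth real surface. -/
instance realManifold {M : Type*} [TopologicalSpace M] [ChartedSpace ℂ M]
    [h : IsManifold 𝓘(ℂ) ω M] : IsManifold 𝓘(ℝ, ℂ) ∞ M := by
  apply isManifold_of_contDiffOn
  intro e e' he he'
  have h1 := ((contDiffGroupoid ω 𝓘(ℂ)).compatible he he').1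
  exact ((ContDiffOn.restrict_scalars ℝ h1).of_le le_top : _)

/-- A complex vector bundle is a real vector bundle. -/
instance realBundle {M : Type*} [TopologicalSpace M] {L : M → Type*}
    [∀ x, NormedAddCommGroup (L x)] [∀ x, InnerProductSpace ℂ (L x)]
    [TopologicalSpace (TotalSpace ℂ L)] [FiberBundle ℂ L] [VectorBundle ℂ ℂ L] :
    VectorBundle ℝ ℂ L where
  trivialization_linear' e he := by
    have := VectorBundle.trivialization_linear' (R := ℂ) e
    refine ⟨fun b hb => ⟨(this.linear b hb).map_add, fun c x => ?_⟩⟩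
    exact (this.linear b hb).map_smul (c : ℂ) x
  continuousOn_coordChange' e e' he he' := by
    have i1 : e.IsLinear ℝ := by
      have := VectorBundle.trivialization_linear' (R := ℂ) e
      exact ⟨fun b hb => ⟨(this.linear b hb).map_add,
        fun c x => (this.linear b hb).map_smul (c : ℂ) x⟩⟩
    have i2 : e'.IsLinear ℝ := by
      have := VectorBundle.trivialization_linear' (R := ℂ) e'
      exact ⟨fun b hb => ⟨(this.linear b hb).map_add,
        fun c x => (this.linear b hb).map_smul (c : ℂ) x⟩⟩
    have h := VectorBundle.continuousOn_coordChange' (R := ℂ) e e'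
    have h2 := (ContinuousLinearMap.restrictScalarsL ℂ ℂ ℂ ℝ ℝ).continuous.comp_continuousOn h
    refine h2.congr fun b hb => ?_
    ext1 y
    exact (e.coordChangeL_apply (R := ℝ) e' hb y).trans
      (e.coordChangeL_apply (R := ℂ) e' hb y).symm

/-! ### Differential forms on a Riemann surface -/

section Forms

variable (M : Type*) [TopologicalSpace M] [ChartedSpace ℂ M]

/-- Complex valued `1`-forms (no regularity imposed). -/
abbrev OneForm := ∀ x : M, TangentSpace 𝓘(ℝ, ℂ) x →L[ℝ] ℂ

/-- Complex valued `2`-forms (no regularity imposed). -/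
abbrev TwoForm := ∀ x : M, TangentSpace 𝓘(ℝ, ℂ) x [⋀^Fin 2]→L[ℝ] ℂ

variable {M}

/-- The expression of a `1`-form in the chart `e`: the pullback by `e.symm`. -/
def OneForm.inChart (α : OneForm M) (e : OpenPartialHomeomorph M ℂ) (z : ℂ) : ℂ →L[ℝ] ℂ :=
  (α (e.symm z)).comp (mfderiv 𝓘(ℝ, ℂ) 𝓘(ℝ, ℂ) e.symm z)

/-- The expression of a `2`-form in the chart `e`: the pullback by `e.symm`. -/
def TwoForm.inChart (τ : TwoForm M) (e : OpenPartialHomeomorph M ℂ) (z : ℂ) :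
    ℂ [⋀^Fin 2]→L[ℝ] ℂ :=
  (τ (e.symm z)).compContinuousLinearMap (mfderiv 𝓘(ℝ, ℂ) 𝓘(ℝ, ℂ) e.symm z)

/-- A `1`-form is smooth if its expression in every chart is. -/
def OneForm.IsSmooth (α : OneForm M) : Prop :=
  ∀ e ∈ atlas ℂ M, ContDiffOn ℝ ∞ (α.inChart e) e.target

/-- A `2`-form is smooth if its expression in every chart is. -/
def TwoForm.IsSmooth (τ : TwoForm M) : Prop :=
  ∀ e ∈ atlas ℂ M, ContDiffOn ℝ ∞ (τ.inChart e) e.target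

/-- A form with values in `i ℝ`. -/
def OneForm.IsImaginary (α : OneForm M) : Prop := ∀ x v, (α x v).re = 0

/-- The exterior derivative of a `1`-form, computed in the preferred chart at each point. -/
def extD (α : OneForm M) : TwoForm M := fun x =>
  (extDeriv (fun z => ContinuousAlternatingMap.ofSubsingleton ℝ ℂ ℂ (0 : Fin 1)
      (α.inChart (chartAt ℂ x) z)) (chartAt ℂ x x)).compContinuousLinearMap
    (mfderiv 𝓘(ℝ, ℂ) 𝓘(ℝ, ℂ) (chartAt ℂ x) x)

/-- The wedge product `(α ∧ β)(v, w) = α(v) β(w) - α(w) β(v)`. -/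
def wedge (α β : OneForm M) : TwoForm M := fun x =>
  (ContinuousAlternatingMap.alternatizeUncurryFin (ContinuousLinearMap.smulRight
    (α x : ℂ →L[ℝ] ℂ)
    (ContinuousAlternatingMap.ofSubsingleton ℝ ℂ ℂ (0 : Fin 1) (β x : ℂ →L[ℝ] ℂ))) :
    ℂ [⋀^Fin 2]→L[ℝ] ℂ)

theorem wedge_apply (α β : OneForm M) (x : M) (v : Fin 2 → TangentSpace 𝓘(ℝ, ℂ) x) :
    wedge α β x v = α x (v 0) * β x (v 1) - α x (v 1) * β x (v 0) := by
  unfold wedge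
  erw [ContinuousAlternatingMap.alternatizeUncurryFin_apply]
  simp [Fin.sum_univ_two, sub_eq_add_neg]
  rfl

/-- The complex structure of the tangent spaces. Mathlib's tangent space at `x` is `ℂ`, through the
differential of the preferred chart at `x`, which is holomorphic. -/
def tangentJ (x : M) : TangentSpace 𝓘(ℝ, ℂ) x →L[ℝ] TangentSpace 𝓘(ℝ, ℂ) x :=
  (Complex.I • ContinuousLinearMap.id ℝ ℂ : ℂ →L[ℝ] ℂ)

/-- The part of type `(1, 0)` of a covector with values in a complex vector space. -/
def part10 {V : Type*} [NormedAddCommGroup V] [NormedSpace ℂ V] {x : M}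
    (η : TangentSpace 𝓘(ℝ, ℂ) x →L[ℝ] V) : TangentSpace 𝓘(ℝ, ℂ) x →L[ℝ] V :=
  (1 / 2 : ℂ) • (η - Complex.I • η.comp (tangentJ x))

/-- The part of type `(0, 1)` of a covector with values in a complex vector space. -/
def part01 {V : Type*} [NormedAddCommGroup V] [NormedSpace ℂ V] {x : M}
    (η : TangentSpace 𝓘(ℝ, ℂ) x →L[ℝ] V) : TangentSpace 𝓘(ℝ, ℂ) x →L[ℝ] V :=
  (1 / 2 : ℂ) • (η + Complex.I • η.comp (tangentJ x))

/-- The Hodge star: `- i` on forms of type `(1, 0)` and `i` on forms of type `(0, 1)`. -/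
def hodgeStar (α : OneForm M) : OneForm M := fun x =>
  -Complex.I • part10 (α x) + Complex.I • part01 (α x)

/-- The operator `∂` on forms of type `(0, 1)`. On a Riemann surface it is the exterior derivative,
because there are no forms of type `(0, 2)`. -/
def del (η : OneForm M) : TwoForm M := extD η

/-- A smooth real positive `2`-form. In a holomorphic chart it is `i ρ dz ∧ d\bar z` with `ρ > 0`
smooth, that is, `i e^{2σ} h² dz ∧ d\bar z` for a conformal metric `h² dz ⊗ d\bar z` and a smooth
real function `σ`. -/
structure IsAreaForm (area : TwoForm M) : Prop where
  smooth : area.IsSmooth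
  real : ∀ x v, (area x v).im = 0
  pos : ∀ (x : M) (v : TangentSpace 𝓘(ℝ, ℂ) x), v ≠ 0 → 0 < (area x ![v, tangentJ x v]).re

section Integral

variable (M) [T2Space M] [CompactSpace M] [IsManifold 𝓘(ℂ) ω M]

/-- A smooth partition of unity subordinate to the preferred charts. -/
def chartPartition : SmoothPartitionOfUnity M 𝓘(ℝ, ℂ) M univ :=
  (SmoothPartitionOfUnity.exists_isSubordinate_chartAt_source 𝓘(ℝ, ℂ) M).choose

variable {M}

/-- The integral of a `2`-form over a compact Riemann surface with its complex orientation: the sum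
of the integrals of `ρ_c τ` in the charts `c`, for a partition of unity `ρ`. -/
def integral (τ : TwoForm M) : ℂ :=
  ∑ᶠ c : M, ∫ z in (chartAt ℂ c).target,
    (chartPartition M c ((chartAt ℂ c).symm z) : ℂ) *
      τ.inChart (chartAt ℂ c) z ![1, Complex.I]

end Integral

end Forms

/-! ### Configurations, the equations, and their linearization -/

section Configurations

variable {M : Type*} [TopologicalSpace M] [ChartedSpace ℂ M]
  (L : M → Type*) [∀ x, NormedAddCommGroup (L x)] [∀ x, InnerProductSpace ℂ (L x)]
  [TopologicalSpace (TotalSpace ℂ L)] [FiberBundle ℂ L] [VectorBundle ℂ ℂ L]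

/-- Sections of `L` (no regularity imposed). -/
abbrev Sec := ∀ x : M, L x

variable {L} in
/-- Smooth sections. -/
def Sec.IsSmooth (s : Sec L) : Prop :=
  ContMDiff 𝓘(ℝ, ℂ) (𝓘(ℝ, ℂ).prod 𝓘(ℝ, ℂ)) ∞ (fun x => TotalSpace.mk' ℂ x (s x))

/-- The Hermitian metric of the bundle is smooth. -/
class IsSmoothHermitian : Prop where
  smooth : ∀ s t : Sec L, s.IsSmooth → t.IsSmooth →
    ContMDiff 𝓘(ℝ, ℂ) 𝓘(ℝ, ℂ) ∞ (fun x => inner ℂ (s x) (t x))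

variable {L}

/-- A connection is unitary if it is complex linear and compatible with the Hermitian metric. -/
structure IsUnitary (A : CovariantDerivative 𝓘(ℝ, ℂ) ℂ L) : Prop where
  complex_linear : ∀ (s : Sec L) (x : M),
    MDifferentiableAt 𝓘(ℝ, ℂ) (𝓘(ℝ, ℂ).prod 𝓘(ℝ, ℂ)) (fun y => TotalSpace.mk' ℂ y (s y)) x →
    ∀ v, A (fun y => Complex.I • s y) x v = Complex.I • A s x v
  metric : ∀ (s t : Sec L) (x : M),
    MDifferentiableAt 𝓘(ℝ, ℂ) (𝓘(ℝ, ℂ).prod 𝓘(ℝ, ℂ)) (fun y => TotalSpace.mk' ℂ y (s y)) x →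
    MDifferentiableAt 𝓘(ℝ, ℂ) (𝓘(ℝ, ℂ).prod 𝓘(ℝ, ℂ)) (fun y => TotalSpace.mk' ℂ y (t y)) x →
    ∀ v, mvfderiv 𝓘(ℝ, ℂ) (fun y => inner ℂ (s y) (t y)) x v =
      inner ℂ (A s x v) (t x) + inner ℂ (s x) (A t x v)

/-- The connection form of `A` in the local frame given by the preferred trivialization `e` at `x₀`:
`∇ s = θ s` for the section `s` with constant coordinate `1` in `e`. -/
def connForm (A : CovariantDerivative 𝓘(ℝ, ℂ) ℂ L) (x₀ : M) : OneForm M := fun y =>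
  ((trivializationAt ℂ L x₀).continuousLinearMapAt ℝ y).comp
    (A (fun y' => (trivializationAt ℂ L x₀).symm y' 1) y)

/-- The curvature `F(A)`: the exterior derivative of the connection form in a local frame. -/
def curvature (A : CovariantDerivative 𝓘(ℝ, ℂ) ℂ L) : TwoForm M := fun x =>
  extD (connForm A x) x

/-- A complex `1`-form as a `1`-form with values in the endomorphisms of `L`. -/
def formEnd (α : OneForm M) (x : M) : L x →L[ℝ] TangentSpace 𝓘(ℝ, ℂ) x →L[ℝ] L x :=
  (((ContinuousLinearMap.lsmul ℝ ℂ : ℂ →L[ℝ] L x →L[ℝ] L x).comp (α x : ℂ →L[ℝ] ℂ)).flip :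
    L x →L[ℝ] ℂ →L[ℝ] L x)

variable (L) in
/-- A triple `(A, Ψ, Φ)`, no regularity imposed. The components of `Ψ` are the sections
`ψ₁ = psi₁` and `\bar ψ₂ = psi₂` of `L`. -/
structure Config where
  conn : CovariantDerivative 𝓘(ℝ, ℂ) ℂ L
  psi₁ : Sec L
  psi₂ : Sec L
  phi : OneForm M

/-- The points of the configuration space: smooth unitary connections, smooth sections of `L ⊕ L`,
smooth imaginary `1`-forms. -/
structure Config.IsSmooth [IsManifold 𝓘(ℂ) ω M] (p : Config L) : Prop where
  unitary : IsUnitary p.conn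
  conn : p.conn.ContMDiffCovariantDerivative ∞
  psi₁ : p.psi₁.IsSmooth
  psi₂ : p.psi₂.IsSmooth
  phi : p.phi.IsSmooth
  phi_imaginary : p.phi.IsImaginary

variable (L) in
/-- An infinitesimal variation `(α, β, γ)` of a configuration, no regularity imposed. The components
of `β` are the sections `β₁ = beta₁` and `\bar β₂ = beta₂` of `L`. -/
structure Variation where
  alpha : OneForm M
  beta₁ : Sec L
  beta₂ : Sec L
  gamma : OneForm M

/-- The tangent vectors of the configuration space. -/
structure Variation.IsSmooth (X : Variation L) : Prop where
  alpha : X.alpha.IsSmooth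
  alpha_imaginary : X.alpha.IsImaginary
  beta₁ : X.beta₁.IsSmooth
  beta₂ : X.beta₂.IsSmooth
  gamma : X.gamma.IsSmooth
  gamma_imaginary : X.gamma.IsImaginary

/-- The point `p + t X` of the affine space of configurations. -/
def Config.move (p : Config L) (X : Variation L) (t : ℝ) : Config L where
  conn := p.conn.addOneForm (formEnd (fun x => t • X.alpha x))
  psi₁ := fun x => p.psi₁ x + t • X.beta₁ x
  psi₂ := fun x => p.psi₂ x + t • X.beta₂ x
  phi := fun x => p.phi x + t • X.gamma x

/-- The operator `\bar∂ + A^{0,1}`. -/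
def delBar (A : CovariantDerivative 𝓘(ℝ, ℂ) ℂ L) (s : Sec L) (x : M) :
    TangentSpace 𝓘(ℝ, ℂ) x →L[ℝ] L x := part01 (A s x)

/-- The defect of `F(A) = (i / 2) (|ψ₁|² + |ψ₂|²) area`. -/
def curvatureDefect (area : TwoForm M) (p : Config L) (x : M) :
    TangentSpace 𝓘(ℝ, ℂ) x [⋀^Fin 2]→L[ℝ] ℂ :=
  curvature p.conn x -
    (Complex.I * (((‖p.psi₁ x‖ ^ 2 + ‖p.psi₂ x‖ ^ 2) / 2 : ℝ) : ℂ)) • area x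

/-- The defect of `∂ Φ^{0,1} = 0`. -/
def higgsDefect (p : Config L) : TwoForm M := del (fun x => part01 (p.phi x))

/-- The form `\bar φ d\bar z`, where `Φ = φ dz - \bar φ d\bar z`, so that
`\bar φ d\bar z = - Φ^{0,1}`. -/
def phiBar (p : Config L) : OneForm M := fun x => -part01 (p.phi x)

/-- The first component of the defect of the Dirac equation,
`(\bar∂ + A^{0,1}) ψ₁ + (1/2) \bar φ d\bar z \bar ψ₂`, at a tangent vector `v`. -/
def diracDefect₁ (p : Config L) (x : M) (v : TangentSpace 𝓘(ℝ, ℂ) x) : L x :=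
  delBar p.conn p.psi₁ x v + ((1 / 2 : ℂ) * phiBar p x v) • p.psi₂ x

/-- The second component of the defect of the Dirac equation,
`- (1/2) \bar φ d\bar z ψ₁ + (\bar∂ + A^{0,1}) \bar ψ₂`, at a tangent vector `v`. -/
def diracDefect₂ (p : Config L) (x : M) (v : TangentSpace 𝓘(ℝ, ℂ) x) : L x :=
  -(((1 / 2 : ℂ) * phiBar p x v) • p.psi₁ x) + delBar p.conn p.psi₂ x v

/-- The space `S` of solutions of the equations. -/
def solutionSpace [IsManifold 𝓘(ℂ) ω M] (area : TwoForm M) : Set (Config L) :=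
  {p | p.IsSmooth ∧ ∀ x, curvatureDefect area p x = 0 ∧ higgsDefect p x = 0 ∧
    (∀ v, diracDefect₁ p x v = 0) ∧ ∀ v, diracDefect₂ p x v = 0}

/-- The tangent space `T_p S`, defined by the linearization of the equations at `p`: the smooth
variations `X` for which the derivative of each equation at `p` in the direction `X` vanishes. -/
def tangentSolution (area : TwoForm M) (p : Config L) : Set (Variation L) :=
  {X | X.IsSmooth ∧ ∀ x,
    (∀ v, HasDerivAt (fun t : ℝ => curvatureDefect area (p.move X t) x v) 0 0) ∧
    (∀ v, HasDerivAt (fun t : ℝ => higgsDefect (p.move X t) x v) 0 0) ∧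
    (∀ v, HasDerivAt (fun t : ℝ => diracDefect₁ (p.move X t) x v) 0 0) ∧
    (∀ v, HasDerivAt (fun t : ℝ => diracDefect₂ (p.move X t) x v) 0 0)}

/-! ### Gauge transformations -/

/-- The action `(A, Ψ, Φ) ↦ (A + u⁻¹ du, u⁻¹ Ψ, Φ)` of a gauge transformation `u : M → U(1)`, here
written as a function to `ℂ`. -/
def gaugeAct (u : M → ℂ) (p : Config L) : Config L where
  conn := p.conn.addOneForm (formEnd (fun x => (u x)⁻¹ • mvfderiv 𝓘(ℝ, ℂ) u x))
  psi₁ := fun x => (u x)⁻¹ • p.psi₁ x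
  psi₂ := fun x => (u x)⁻¹ • p.psi₂ x
  phi := p.phi

/-- `X` is the velocity at time `0` of the curve `c` of configurations. -/
structure IsVelocity (c : ℝ → Config L) (X : Variation L) : Prop where
  conn : ∀ (s : Sec L) x v, HasDerivAt (fun t => (c t).conn s x v) (X.alpha x v • s x) 0
  psi₁ : ∀ x, HasDerivAt (fun t => (c t).psi₁ x) (X.beta₁ x) 0
  psi₂ : ∀ x, HasDerivAt (fun t => (c t).psi₂ x) (X.beta₂ x) 0
  phi : ∀ x v, HasDerivAt (fun t => (c t).phi x v) (X.gamma x v) 0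

/-- The Lie algebra of the gauge group: smooth functions with values in `i ℝ`. -/
structure IsInfGauge (ζ : M → ℂ) : Prop where
  smooth : ContMDiff 𝓘(ℝ, ℂ) 𝓘(ℝ, ℂ) ∞ ζ
  imaginary : ∀ x, (ζ x).re = 0

/-- The tangent space `T_p O_p` of the gauge orbit of `p`: the velocities at `p` of the curves
`t ↦ exp(t ζ) · p`, with `ζ` in the Lie algebra of the gauge group
(so that `exp(t ζ)` has values in `U(1)`). -/
def tangentOrbit (p : Config L) : Set (Variation L) :=
  {X | ∃ ζ : M → ℂ, IsInfGauge ζ ∧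
    IsVelocity (fun t : ℝ => gaugeAct (fun x => Complex.exp (t * ζ x)) p) X}

/-! ### The metric and the almost complex structure -/

/-- `I (α, β, γ) = (*α, i β, *γ)`. -/
def complexStructure (X : Variation L) : Variation L where
  alpha := hodgeStar X.alpha
  beta₁ := fun x => Complex.I • X.beta₁ x
  beta₂ := fun x => Complex.I • X.beta₂ x
  gamma := hodgeStar X.gamma

/-- `g(X, Y) = ∫ *α₁ ∧ α₂ + ∫ Re ⟨β, η⟩ area + ∫ *γ₁ ∧ γ₂`. For forms with values in `i ℝ` all the
integrands are real. -/
def metric [T2Space M] [CompactSpace M] [IsManifold 𝓘(ℂ) ω M] (area : TwoForm M)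
    (X Y : Variation L) : ℝ :=
  (integral (wedge (hodgeStar X.alpha) Y.alpha)
    + integral (fun x => (((inner ℂ (Y.beta₁ x) (X.beta₁ x) +
        inner ℂ (Y.beta₂ x) (X.beta₂ x) : ℂ).re : ℝ) : ℂ) • area x)
    + integral (wedge (hodgeStar X.gamma) Y.gamma)).re

end Configurations

end ReducedSW

end

set_option linter.unusedSectionVars false

noncomputable section

namespace ReducedSW

/-! ### Transition maps and the expression of forms in charts -/

section Charts

/-! The linearized Dirac equations and the linearization of `∂Φ^{0,1} = 0` involve `α` and `γ` only
through their `(0,1)` parts and are complex linear in `(α^{0,1}, β, γ^{0,1})`. Since `(*α)^{0,1} = i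
α^{0,1}` (`part01_hodgeStar`), replacing `X` by `IX` multiplies these equations by `i`, so they
still hold. What remains for `IX` is the linearized curvature equation, `τ = 0` with `τ = d*α - i
Re(⟨ψ₁, iβ₁⟩ + ⟨ψ₂, iβ₂⟩) area`, where `ψ₂` and `β₂` stand for the second components, as sections of
`L` (`complexStructure_mem_iff`).

This `τ` is also what orthogonality to the gauge orbit tests. Stokes' theorem turns `∫ *α ∧ dζ` into
`∫ ζ d*α`, and for imaginary `ζ` the real pairing of `β` with `-ζΨ` is `ζ` times the second term of
`τ`. Hence `g(X, (dζ, -ζΨ, 0)) = Re ∫ ζ τ` (`metric_infGauge`). If `τ = 0`, this vanishes for all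
`ζ`. Conversely `τ` is imaginary, so `τ = i h area` with `h` real and smooth, and `ζ = -i h` gives
`∫ h² area = 0`, whence `h = 0` (`eq_zero_of_integral_eq_zero`).

The analytic input is Stokes' theorem (`integral_extD`) and the positivity of the integral
(`integral_area_smul_eq_zero`), both derived from the definition of `integral` by a partition of
unity. The derivatives in `t` become algebra because every equation is a quadratic polynomial along
`p + tX` (`mem_tangentSolution_iff`), and the orbit directions are made explicit in
`mem_tangentOrbit_iff`. -/

theorem mem_transition {M : Type*} [TopologicalSpace M] {e e' : OpenPartialHomeomorph M ℂ} {z : ℂ}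
    (hz : z ∈ e.target) (h : e.symm z ∈ e'.source) : z ∈ (e.symm ≫ₕ e').source := by
  simp [hz, h]

variable {M : Type*} [TopologicalSpace M] [ChartedSpace ℂ M]

/-- The differential of the inverse of a chart, read in the preferred coordinates of the tangent
space. -/
def chartDeriv (e : OpenPartialHomeomorph M ℂ) (z : ℂ) : ℂ →L[ℝ] ℂ :=
  mfderiv 𝓘(ℝ, ℂ) 𝓘(ℝ, ℂ) e.symm z

/-- A covector, read in the preferred coordinates. -/
def OneForm.coord (α : OneForm M) (x : M) : ℂ →L[ℝ] ℂ := α x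

/-- An alternating form, read in the preferred coordinates. -/
def TwoForm.coord (τ : TwoForm M) (x : M) : ℂ [⋀^Fin 2]→L[ℝ] ℂ := τ x

theorem OneForm.inChart_eq (α : OneForm M) (e : OpenPartialHomeomorph M ℂ) (z : ℂ) :
    α.inChart e z = (OneForm.coord α (e.symm z)).comp (chartDeriv e z) := rfl

theorem TwoForm.inChart_eq (τ : TwoForm M) (e : OpenPartialHomeomorph M ℂ) (z : ℂ) :
    τ.inChart e z = (TwoForm.coord τ (e.symm z)).compContinuousLinearMap (chartDeriv e z) := rfl

variable [IsManifold 𝓘(ℂ) ω M]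

theorem contDiffOn_transition_complex {e e' : OpenPartialHomeomorph M ℂ} (he : e ∈ atlas ℂ M)
    (he' : e' ∈ atlas ℂ M) : ContDiffOn ℂ ω (e' ∘ e.symm) (e.symm ≫ₕ e').source := by
  have h := ((contDiffGroupoid ω 𝓘(ℂ)).compatible he he').1
  simpa [contDiffPregroupoid] using h

theorem contDiffOn_transition {e e' : OpenPartialHomeomorph M ℂ} (he : e ∈ atlas ℂ M)
    (he' : e' ∈ atlas ℂ M) : ContDiffOn ℝ ∞ (e' ∘ e.symm) (e.symm ≫ₕ e').source :=
  ((contDiffOn_transition_complex he he').restrict_scalars ℝ).of_le le_top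

theorem contDiffAt_transition {e e' : OpenPartialHomeomorph M ℂ} (he : e ∈ atlas ℂ M)
    (he' : e' ∈ atlas ℂ M) {z : ℂ} (hz : z ∈ (e.symm ≫ₕ e').source) :
    ContDiffAt ℝ ∞ (e' ∘ e.symm) z :=
  (contDiffOn_transition he he').contDiffAt ((e.symm ≫ₕ e').open_source.mem_nhds hz)

theorem fderiv_transition_apply {e e' : OpenPartialHomeomorph M ℂ} (he : e ∈ atlas ℂ M)
    (he' : e' ∈ atlas ℂ M) {z : ℂ} (hz : z ∈ (e.symm ≫ₕ e').source) (v : ℂ) :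
    fderiv ℝ (e' ∘ e.symm) z v = deriv (e' ∘ e.symm) z * v := by
  have h : DifferentiableAt ℂ (e' ∘ e.symm) z :=
    ((contDiffOn_transition_complex he he').contDiffAt
      ((e.symm ≫ₕ e').open_source.mem_nhds hz)).differentiableAt (by simp)
  rw [h.fderiv_restrictScalars ℝ]
  simp [mul_comm]

/-- The tangent space at a point is read through the preferred chart there, so the differential of
`e.symm` is that of a transition map, whose target chart varies with `z`. -/
theorem chartDeriv_eq_fderiv {e : OpenPartialHomeomorph M ℂ} (he : e ∈ atlas ℂ M) {z : ℂ}
    (hz : z ∈ e.target) :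
    chartDeriv e z = fderiv ℝ (chartAt ℂ (e.symm z) ∘ e.symm) z := by
  have h : MDifferentiableAt 𝓘(ℝ, ℂ) 𝓘(ℝ, ℂ) e.symm z := mdifferentiableAt_atlas_symm he hz
  rw [chartDeriv, h.mfderiv]
  simp [writtenInExtChartAt]
  rfl

theorem chartDeriv_comp {e e' : OpenPartialHomeomorph M ℂ} (he : e ∈ atlas ℂ M)
    (he' : e' ∈ atlas ℂ M) {z : ℂ} (hz : z ∈ e.target) (h : e.symm z ∈ e'.source) :
    chartDeriv e z = (chartDeriv e' (e' (e.symm z))).comp (fderiv ℝ (e' ∘ e.symm) z) := by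
  set x := e.symm z with hx
  have hw : e' x ∈ e'.target := e'.map_source h
  have hxw : e'.symm (e' x) = x := e'.left_inv h
  rw [chartDeriv_eq_fderiv he hz, chartDeriv_eq_fderiv he' hw, hxw, ← hx]
  have h1 : DifferentiableAt ℝ (e' ∘ e.symm) z :=
    (contDiffAt_transition he he' (mem_transition hz h)).differentiableAt (by simp)
  have h2 : DifferentiableAt ℝ (chartAt ℂ x ∘ e'.symm) (e' x) :=
    (contDiffAt_transition he' (chart_mem_atlas ℂ x) (mem_transition hw
      (by rw [hxw]; exact mem_chart_source ℂ x))).differentiableAt (by simp)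
  have h3 := fderiv_comp z (g := chartAt ℂ x ∘ e'.symm) (f := e' ∘ e.symm) h2 h1
  have h4 : (chartAt ℂ x ∘ e.symm) =ᶠ[𝓝 z] (chartAt ℂ x ∘ e'.symm) ∘ (e' ∘ e.symm) := by
    filter_upwards [(e.symm ≫ₕ e').open_source.mem_nhds (mem_transition hz h)] with w hw
    have : e.symm w ∈ e'.source := by simpa using hw.2
    simp [e'.left_inv this]
  rw [h4.fderiv_eq, h3]
  rfl

/-- Transition maps are holomorphic, so their real differentials are multiplications by complex
numbers. This makes the star and the type decomposition independent of the chart. -/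
theorem chartDeriv_smul_I {e : OpenPartialHomeomorph M ℂ} (he : e ∈ atlas ℂ M) {z : ℂ}
    (hz : z ∈ e.target) (v : ℂ) :
    chartDeriv e z (Complex.I * v) = Complex.I * chartDeriv e z v := by
  have hm := mem_transition hz (mem_chart_source ℂ (e.symm z))
  rw [chartDeriv_eq_fderiv he hz, fderiv_transition_apply he (chart_mem_atlas ℂ _) hm,
    fderiv_transition_apply he (chart_mem_atlas ℂ _) hm]
  ring

theorem chartDeriv_chartAt (x : M) :
    chartDeriv (chartAt ℂ x) (chartAt ℂ x x) = ContinuousLinearMap.id ℝ ℂ := by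
  have hx := mem_chart_source ℂ x
  have hz := (chartAt ℂ x).map_source hx
  rw [chartDeriv_eq_fderiv (chart_mem_atlas ℂ x) hz, (chartAt ℂ x).left_inv hx]
  have : (chartAt ℂ x ∘ (chartAt ℂ x).symm) =ᶠ[𝓝 (chartAt ℂ x x)] id := by
    filter_upwards [(chartAt ℂ x).open_target.mem_nhds hz] with w hw
    exact (chartAt ℂ x).right_inv hw
  rw [this.fderiv_eq, fderiv_id]

/-- The chain rule from the preferred chart to `e` factors the identity through this map. It is
therefore surjective, and by equality of dimensions injective. -/
theorem chartDeriv_injective {e : OpenPartialHomeomorph M ℂ} (he : e ∈ atlas ℂ M) {z : ℂ}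
    (hz : z ∈ e.target) : Function.Injective (chartDeriv e z) := by
  set x := e.symm z with hx
  have hxs : x ∈ e.source := e.map_target hz
  have h := chartDeriv_comp (chart_mem_atlas ℂ x) he
    ((chartAt ℂ x).map_source (mem_chart_source ℂ x))
    (by rwa [(chartAt ℂ x).left_inv (mem_chart_source ℂ x)])
  rw [chartDeriv_chartAt, (chartAt ℂ x).left_inv (mem_chart_source ℂ x)] at h
  rw [show e x = z from e.right_inv hz] at h
  have hs : Function.Surjective (chartDeriv e z) := fun v =>
    ⟨_, (congrArg (fun f : ℂ →L[ℝ] ℂ => f v) h).symm⟩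
  exact (LinearMap.injective_iff_surjective
    (f := (chartDeriv e z).toLinearMap)).2 hs

theorem OneForm.inChart_comp (α : OneForm M) {e e' : OpenPartialHomeomorph M ℂ}
    (he : e ∈ atlas ℂ M) (he' : e' ∈ atlas ℂ M) {z : ℂ} (hz : z ∈ e.target)
    (h : e.symm z ∈ e'.source) :
    α.inChart e z = (α.inChart e' (e' (e.symm z))).comp (fderiv ℝ (e' ∘ e.symm) z) := by
  rw [inChart_eq, inChart_eq, chartDeriv_comp he he' hz h, e'.left_inv h]
  rfl

theorem TwoForm.inChart_comp (τ : TwoForm M) {e e' : OpenPartialHomeomorph M ℂ}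
    (he : e ∈ atlas ℂ M) (he' : e' ∈ atlas ℂ M) {z : ℂ} (hz : z ∈ e.target)
    (h : e.symm z ∈ e'.source) :
    τ.inChart e z = (τ.inChart e' (e' (e.symm z))).compContinuousLinearMap
      (fderiv ℝ (e' ∘ e.symm) z) := by
  rw [inChart_eq, inChart_eq, chartDeriv_comp he he' hz h, e'.left_inv h]
  rfl

theorem OneForm.inChart_chartAt (α : OneForm M) (x : M) :
    α.inChart (chartAt ℂ x) (chartAt ℂ x x) = OneForm.coord α x := by
  rw [inChart_eq, chartDeriv_chartAt, (chartAt ℂ x).left_inv (mem_chart_source ℂ x)]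
  rfl

theorem alternating_swap (τ : ℂ [⋀^Fin 2]→L[ℝ] ℂ) (v w : ℂ) : τ ![v, w] = -τ ![w, v] := by
  have h := τ.toAlternatingMap.map_swap ![w, v] (i := 0) (j := 1) (by decide)
  have hsw : (![w, v] ∘ Equiv.swap (0 : Fin 2) 1 : Fin 2 → ℂ) = ![v, w] := by
    ext i; fin_cases i <;> simp
  rw [hsw] at h
  exact h

/-- An alternating `2`-form on `ℂ` is determined by its value on `(1, i)`. -/
theorem alternating_apply_eq_det (τ : ℂ [⋀^Fin 2]→L[ℝ] ℂ) (v w : ℂ) :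
    τ ![v, w] = ((v.re * w.im - v.im * w.re : ℝ) : ℂ) * τ ![1, Complex.I] := by
  have h0 : ∀ u, τ ![u, u] = 0 := fun u =>
    τ.map_eq_zero_of_eq _ (i := 0) (j := 1) rfl (by decide)
  have hl : ∀ u c : ℂ, τ ![u, c] = u.re • τ ![1, c] + u.im • τ ![Complex.I, c] := by
    intro u c
    conv_lhs => rw [show u = u.re • (1 : ℂ) + u.im • Complex.I by simp [Complex.re_add_im]]
    rw [τ.vecCons_add, τ.vecCons_smul, τ.vecCons_smul]
  rw [hl, alternating_swap τ 1 w, alternating_swap τ Complex.I w, hl, hl w Complex.I, h0, h0,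
    alternating_swap τ Complex.I 1]
  simp only [Complex.real_smul]
  push_cast
  ring

theorem alternating_ext {τ τ' : ℂ [⋀^Fin 2]→L[ℝ] ℂ} (h : τ ![1, Complex.I] = τ' ![1, Complex.I]) :
    τ = τ' := by
  ext v
  have hv : v = ![v 0, v 1] := by ext i; fin_cases i <;> rfl
  rw [hv, alternating_apply_eq_det, alternating_apply_eq_det τ', h]

end Charts

/-! ### The exterior derivative, the Hodge star and types -/

section ExteriorDerivative

/-- A family of covectors of `ℂ` as a family of alternating forms. -/
def toAlternating (θ : ℂ → ℂ →L[ℝ] ℂ) (z : ℂ) : ℂ [⋀^Fin 1]→L[ℝ] ℂ :=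
  ContinuousAlternatingMap.ofSubsingleton ℝ ℂ ℂ (0 : Fin 1) (θ z)

theorem toAlternating_differentiableAt {θ : ℂ → ℂ →L[ℝ] ℂ} {z : ℂ}
    (h : DifferentiableAt ℝ θ z) : DifferentiableAt ℝ (toAlternating θ) z :=
  (ContinuousAlternatingMap.ofSubsingletonLIE (𝕜 := ℝ) (E := ℂ) (F := ℂ)
    (0 : Fin 1)).toContinuousLinearEquiv.differentiableAt.comp z h

theorem extDeriv_toAlternating_apply {θ : ℂ → ℂ →L[ℝ] ℂ} {z : ℂ}
    (h : DifferentiableAt ℝ θ z) (v w : ℂ) :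
    extDeriv (toAlternating θ) z ![v, w] = fderiv ℝ θ z v w - fderiv ℝ θ z w v := by
  have h1 : ∀ u a, fderiv ℝ (fun x => toAlternating θ x ![u]) z a = fderiv ℝ θ z a u := by
    intro u a
    have : (fun x => toAlternating θ x ![u]) = fun x => θ x u := by
      ext x; simp [toAlternating]
    rw [this, fderiv_clm_apply h (differentiableAt_const u)]
    simp
  have e0 : (Fin.removeNth 0 ![v, w] : Fin 1 → ℂ) = ![w] := by ext i; fin_cases i; rfl
  have e1 : (Fin.removeNth 1 ![v, w] : Fin 1 → ℂ) = ![v] := by ext i; fin_cases i; rfl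
  rw [extDeriv_apply (toAlternating_differentiableAt h)]
  refine (Fin.sum_univ_two _).trans ?_
  rw [e0, e1, h1, h1]
  simp [sub_eq_add_neg]

variable {M : Type*} [TopologicalSpace M] [ChartedSpace ℂ M]

/-- A `1`-form is differentiable at a point if its expression in the preferred chart is. -/
def OneForm.DiffAt (α : OneForm M) (x : M) : Prop :=
  DifferentiableAt ℝ (α.inChart (chartAt ℂ x)) (chartAt ℂ x x)

theorem OneForm.IsSmooth.diffAt {α : OneForm M} (h : α.IsSmooth) (x : M) : α.DiffAt x :=
  ((h _ (chart_mem_atlas ℂ x)).contDiffAt ((chartAt ℂ x).open_target.mem_nhds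
    ((chartAt ℂ x).map_source (mem_chart_source ℂ x)))).differentiableAt (by simp)

theorem mfderiv_chartAt_self [IsManifold 𝓘(ℂ) ω M] (x : M) :
    (mfderiv 𝓘(ℝ, ℂ) 𝓘(ℝ, ℂ) (chartAt ℂ x) x : ℂ →L[ℝ] ℂ) = ContinuousLinearMap.id ℝ ℂ := by
  have : IsManifold 𝓘(ℝ, ℂ) 1 M := IsManifold.of_le (n := ∞) (by simp)
  have h := mfderiv_extChartAt_self (I := 𝓘(ℝ, ℂ)) (x := x)
  simpa using! h

theorem OneForm.IsSmooth.differentiableAt {α : OneForm M} (h : α.IsSmooth)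
    {e : OpenPartialHomeomorph M ℂ} (he : e ∈ atlas ℂ M) {z : ℂ} (hz : z ∈ e.target) :
    DifferentiableAt ℝ (α.inChart e) z :=
  ((h e he).contDiffAt (e.open_target.mem_nhds hz)).differentiableAt (by simp)

theorem twoForm_ext {τ τ' : TwoForm M} {x : M}
    (h : TwoForm.coord τ x ![1, Complex.I] = TwoForm.coord τ' x ![1, Complex.I]) : τ x = τ' x :=
  alternating_ext h

theorem OneForm.IsSmooth.add {α β : OneForm M} (h : α.IsSmooth) (h' : β.IsSmooth) :
    OneForm.IsSmooth (fun y => α y + β y) := fun e he => (h e he).add (h' e he)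

theorem OneForm.IsSmooth.const_smul {α : OneForm M} (c : ℂ) (h : α.IsSmooth) :
    OneForm.IsSmooth (fun y => c • α y) := fun e he => (h e he).const_smul c

theorem TwoForm.contDiffOn_apply {τ : TwoForm M} (h : τ.IsSmooth)
    {e : OpenPartialHomeomorph M ℂ} (he : e ∈ atlas ℂ M) (v : Fin 2 → ℂ) :
    ContDiffOn ℝ ∞ (fun z => τ.inChart e z v) e.target :=
  (ContinuousAlternatingMap.apply ℝ ℂ ℂ v).contDiff.comp_contDiffOn (h e he)

/-- The two multiples of `α v` cancel. What is left is a real operator, so the star preserves both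
smoothness and imaginary values. -/
theorem hodgeStar_coord (α : OneForm M) (x : M) (v : ℂ) :
    OneForm.coord (hodgeStar α) x v = -OneForm.coord α x (Complex.I * v) := by
  have : OneForm.coord (hodgeStar α) x v =
    -Complex.I * ((1 / 2) * (OneForm.coord α x v - Complex.I * OneForm.coord α x (Complex.I * v)))
    + Complex.I * ((1 / 2) * (OneForm.coord α x v
      + Complex.I * OneForm.coord α x (Complex.I * v))) := rfl
  rw [this]
  ring_nf
  simp

theorem part01_coord (α : OneForm M) (x : M) (v : ℂ) :
    OneForm.coord (fun y => part01 (α y)) x v =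
      (1 / 2) * (OneForm.coord α x v + Complex.I * OneForm.coord α x (Complex.I * v)) := rfl

/-- This is the source of the complex linearity of the Dirac and Higgs equations: on `(0,1)` parts
the complex structure is multiplication by `i`. -/
theorem part01_hodgeStar (α : OneForm M) (x : M) :
    part01 (hodgeStar α x) = Complex.I • part01 (α x) := by
  have h : OneForm.coord (fun y => part01 (hodgeStar α y)) x =
      OneForm.coord (fun y => Complex.I • part01 (α y)) x := by
    ext v
    have : OneForm.coord (fun y => Complex.I • part01 (α y)) x v =
      Complex.I * OneForm.coord (fun y => part01 (α y)) x v := rfl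
    rw [this, part01_coord, part01_coord, hodgeStar_coord, hodgeStar_coord, ← mul_assoc,
      Complex.I_mul_I, neg_one_mul, map_neg]
    ring_nf
    simp
    ring
  exact h

theorem hodgeStar_isImaginary {α : OneForm M} (h : α.IsImaginary) :
    (hodgeStar α).IsImaginary := by
  intro x v
  have h1 : hodgeStar α x v = -OneForm.coord α x (Complex.I * (show ℂ from v)) :=
    hodgeStar_coord α x v
  have h2 : (OneForm.coord α x (Complex.I * (show ℂ from v))).re = 0 := h x _
  rw [h1, Complex.neg_re, h2, neg_zero]

variable [IsManifold 𝓘(ℂ) ω M]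

theorem extD_coord (α : OneForm M) (x : M) :
    TwoForm.coord (extD α) x =
      extDeriv (toAlternating (α.inChart (chartAt ℂ x))) (chartAt ℂ x x) := by
  have h : TwoForm.coord (extD α) x =
      (extDeriv (toAlternating (α.inChart (chartAt ℂ x))) (chartAt ℂ x x)).compContinuousLinearMap
        (mfderiv 𝓘(ℝ, ℂ) 𝓘(ℝ, ℂ) (chartAt ℂ x) x : ℂ →L[ℝ] ℂ) := rfl
  rw [h, mfderiv_chartAt_self]
  rfl

theorem extD_coord_apply {α : OneForm M} {x : M} (h : α.DiffAt x) (v w : ℂ) :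
    TwoForm.coord (extD α) x ![v, w] =
      fderiv ℝ (α.inChart (chartAt ℂ x)) (chartAt ℂ x x) v w -
      fderiv ℝ (α.inChart (chartAt ℂ x)) (chartAt ℂ x x) w v := by
  rw [extD_coord, extDeriv_toAlternating_apply h]

/-- The exterior derivative may be computed in any chart. -/
theorem extD_inChart {α : OneForm M} (h : α.IsSmooth) {e : OpenPartialHomeomorph M ℂ}
    (he : e ∈ atlas ℂ M) {z : ℂ} (hz : z ∈ e.target) :
    (extD α).inChart e z = extDeriv (toAlternating (α.inChart e)) z := by
  set x := e.symm z with hx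
  have hc := chart_mem_atlas ℂ x
  have hm : z ∈ (e.symm ≫ₕ chartAt ℂ x).source := mem_transition hz (mem_chart_source ℂ x)
  have hd : DifferentiableAt ℝ (toAlternating (α.inChart (chartAt ℂ x)))
      ((chartAt ℂ x ∘ e.symm) z) := toAlternating_differentiableAt (h.diffAt x)
  -- The exterior derivative commutes with pullback by the transition map; the side condition is the
  -- regularity required for the symmetry of second derivatives.
  have hp := extDeriv_pullback hd (contDiffAt_transition he hc hm) (by
    rw [minSmoothness_of_isRCLikeNormedField]
    exact WithTop.coe_le_coe.2 le_top)
  rw [TwoForm.inChart_eq, extD_coord, chartDeriv_eq_fderiv he hz]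
  refine hp.symm.trans (Filter.EventuallyEq.extDeriv_eq ?_)
  filter_upwards [(e.symm ≫ₕ chartAt ℂ x).open_source.mem_nhds hm] with w hw
  have hw' : w ∈ e.target ∧ e.symm w ∈ (chartAt ℂ x).source := by simpa using hw
  rw [toAlternating, toAlternating, OneForm.inChart_comp α he hc hw'.1 hw'.2]
  ext v
  rfl

theorem extD_inChart_apply {α : OneForm M} (h : α.IsSmooth) {e : OpenPartialHomeomorph M ℂ}
    (he : e ∈ atlas ℂ M) {z : ℂ} (hz : z ∈ e.target) (v w : ℂ) :
    (extD α).inChart e z ![v, w] =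
      fderiv ℝ (α.inChart e) z v w - fderiv ℝ (α.inChart e) z w v := by
  rw [extD_inChart h he hz, extDeriv_toAlternating_apply (h.differentiableAt he hz)]

/-- Differentiability at the one point is the right hypothesis: a connection form is controlled only
on the domain of its local frame. -/
theorem extD_add {α β : OneForm M} {x : M} (h : α.DiffAt x) (h' : β.DiffAt x) :
    extD (fun y => α y + β y) x = extD α x + extD β x := by
  have e : OneForm.inChart (fun y => α y + β y) (chartAt ℂ x) =
    fun z => α.inChart (chartAt ℂ x) z + β.inChart (chartAt ℂ x) z := rfl
  have hd : OneForm.DiffAt (fun y => α y + β y) x := DifferentiableAt.add h h'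
  refine twoForm_ext (τ' := fun y => extD α y + extD β y) ?_
  have e2 : TwoForm.coord (fun y => extD α y + extD β y) x ![1, Complex.I] =
    TwoForm.coord (extD α) x ![1, Complex.I] + TwoForm.coord (extD β) x ![1, Complex.I] := rfl
  rw [e2, extD_coord_apply hd, extD_coord_apply h, extD_coord_apply h', e,
    fderiv_fun_add h h']
  simp only [add_apply]
  ring

theorem extD_const_smul {α : OneForm M} {x : M} (c : ℂ) (h : α.DiffAt x) :
    extD (fun y => c • α y) x = c • extD α x := by
  have e : OneForm.inChart (fun y => c • α y) (chartAt ℂ x) =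
    fun z => c • α.inChart (chartAt ℂ x) z := rfl
  have hd : OneForm.DiffAt (fun y => c • α y) x := DifferentiableAt.const_smul h c
  refine twoForm_ext (τ' := fun y => c • extD α y) ?_
  have e2 : TwoForm.coord (fun y => c • extD α y) x ![1, Complex.I] =
    c • TwoForm.coord (extD α) x ![1, Complex.I] := rfl
  rw [e2, extD_coord_apply hd, extD_coord_apply h, e,
    fderiv_fun_const_smul h]
  simp only [smul_apply, smul_sub]

/-- Locality. It allows forms to be compared on the domain of a trivialization, or off a support,
only. -/
theorem extD_congr {α β : OneForm M} {x : M} (h : ∀ᶠ y in 𝓝 x, α y = β y) :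
    extD α x = extD β x := by
  have hs : (chartAt ℂ x).symm (chartAt ℂ x x) = x :=
    (chartAt ℂ x).left_inv (mem_chart_source ℂ x)
  have hc : Filter.Tendsto (chartAt ℂ x).symm (𝓝 (chartAt ℂ x x)) (𝓝 x) := by
    have := (chartAt ℂ x).continuousAt_symm
      ((chartAt ℂ x).map_source (mem_chart_source ℂ x))
    rwa [ContinuousAt, hs] at this
  have h1 : TwoForm.coord (extD α) x = TwoForm.coord (extD β) x := by
    rw [extD_coord, extD_coord]
    refine Filter.EventuallyEq.extDeriv_eq ?_
    filter_upwards [hc.eventually h] with z hz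
    have : OneForm.coord α ((chartAt ℂ x).symm z) = OneForm.coord β ((chartAt ℂ x).symm z) := hz
    rw [toAlternating, toAlternating, OneForm.inChart_eq, OneForm.inChart_eq, this]
  exact h1

/-! ### Smooth functions and forms -/

theorem contDiffOn_comp_symm {f : M → ℂ} (hf : ContMDiff 𝓘(ℝ, ℂ) 𝓘(ℝ, ℂ) ∞ f)
    {e : OpenPartialHomeomorph M ℂ} (he : e ∈ atlas ℂ M) :
    ContDiffOn ℝ ∞ (f ∘ e.symm) e.target := by
  have h1 := contMDiffOn_symm_of_mem_maximalAtlas (I := 𝓘(ℝ, ℂ)) (n := ∞)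
    (IsManifold.subset_maximalAtlas he)
  exact contMDiffOn_iff_contDiffOn.1 (hf.comp_contMDiffOn h1)

theorem contMDiff_of_comp_symm {f : M → ℂ}
    (hf : ∀ e ∈ atlas ℂ M, ContDiffOn ℝ ∞ (f ∘ e.symm) e.target) :
    ContMDiff 𝓘(ℝ, ℂ) 𝓘(ℝ, ℂ) ∞ f := by
  intro x
  have h1 := contMDiffOn_of_mem_maximalAtlas (I := 𝓘(ℝ, ℂ)) (n := ∞)
    (IsManifold.subset_maximalAtlas (chart_mem_atlas ℂ x))
  have h2 := (contMDiffOn_iff_contDiffOn.2 (hf _ (chart_mem_atlas ℂ x))).comp h1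
    (fun y hy => (chartAt ℂ x).map_source hy)
  have h3 : ContMDiffOn 𝓘(ℝ, ℂ) 𝓘(ℝ, ℂ) ∞ f (chartAt ℂ x).source :=
    h2.congr fun y hy => by simp [(chartAt ℂ x).left_inv hy]
  exact h3.contMDiffAt ((chartAt ℂ x).open_source.mem_nhds (mem_chart_source ℂ x))

/-- The differential of a function. -/
def dOf (f : M → ℂ) : OneForm M := fun x => mvfderiv 𝓘(ℝ, ℂ) f x

theorem dOf_inChart {f : M → ℂ} (hf : ContMDiff 𝓘(ℝ, ℂ) 𝓘(ℝ, ℂ) ∞ f)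
    {e : OpenPartialHomeomorph M ℂ} (he : e ∈ atlas ℂ M) {z : ℂ} (hz : z ∈ e.target) :
    (dOf f).inChart e z = fderiv ℝ (f ∘ e.symm) z := by
  have h := mfderiv_comp (I := 𝓘(ℝ, ℂ)) (I' := 𝓘(ℝ, ℂ)) (I'' := 𝓘(ℝ, ℂ)) z (g := f) (f := e.symm)
    ((hf _).mdifferentiableAt (by simp)) (mdifferentiableAt_atlas_symm he hz)
  rw [mfderiv_eq_fderiv] at h
  exact h.symm

theorem OneForm.IsSmooth.smul {α : OneForm M} {f : M → ℂ} (hf : ContMDiff 𝓘(ℝ, ℂ) 𝓘(ℝ, ℂ) ∞ f)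
    (h : α.IsSmooth) : OneForm.IsSmooth (fun y => f y • α y) :=
  fun e he => (contDiffOn_comp_symm hf he).smul (h e he)

theorem extD_contDiffOn {α : OneForm M} (h : α.IsSmooth) {e : OpenPartialHomeomorph M ℂ}
    (he : e ∈ atlas ℂ M) :
    ContDiffOn ℝ ∞ (fun z => (extD α).inChart e z ![1, Complex.I]) e.target := by
  have h1 : ContDiffOn ℝ ∞ (fderiv ℝ (α.inChart e)) e.target :=
    (h e he).fderiv_of_isOpen (m := ∞) e.open_target (by simp)
  refine (((h1.clm_apply contDiffOn_const).clm_apply contDiffOn_const).sub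
    ((h1.clm_apply contDiffOn_const).clm_apply contDiffOn_const)).congr
    fun z hz => extD_inChart_apply h he hz 1 Complex.I

theorem extD_smul {α : OneForm M} {f : M → ℂ} (hf : ContMDiff 𝓘(ℝ, ℂ) 𝓘(ℝ, ℂ) ∞ f)
    (h : α.IsSmooth) (x : M) :
    extD (fun y => f y • α y) x = wedge (dOf f) α x + f x • extD α x := by
  set c := chartAt ℂ x with hc
  have hca : c ∈ atlas ℂ M := chart_mem_atlas ℂ x
  have hz : c x ∈ c.target := c.map_source (mem_chart_source ℂ x)
  have hs : c.symm (c x) = x := c.left_inv (mem_chart_source ℂ x)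
  have hfd : DifferentiableAt ℝ (f ∘ c.symm) (c x) :=
    ((contDiffOn_comp_symm hf hca).contDiffAt (c.open_target.mem_nhds hz)).differentiableAt
      (by simp)
  have e : OneForm.inChart (fun y => f y • α y) c = fun z => (f ∘ c.symm) z • α.inChart c z := rfl
  refine twoForm_ext (τ' := fun y => wedge (dOf f) α y + f y • extD α y) ?_
  have e2 : TwoForm.coord (fun y => wedge (dOf f) α y + f y • extD α y) x ![1, Complex.I] =
    (OneForm.coord (dOf f) x 1 * OneForm.coord α x Complex.I -
      OneForm.coord (dOf f) x Complex.I * OneForm.coord α x 1) +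
    f x * TwoForm.coord (extD α) x ![1, Complex.I] := by
    exact congrArg (fun a : ℂ => a + f x * TwoForm.coord (extD α) x ![1, Complex.I])
      (wedge_apply (dOf f) α x ![(1 : ℂ), Complex.I])
  rw [e2, extD_coord_apply ((h.smul hf).diffAt x), extD_coord_apply (h.diffAt x), ← hc, e,
    fderiv_fun_smul hfd (h.diffAt x), ← OneForm.inChart_chartAt, ← OneForm.inChart_chartAt,
    dOf_inChart hf hca hz]
  simp only [add_apply, smul_apply,
    ContinuousLinearMap.smulRight_apply, smul_eq_mul, Function.comp, hs]
  ring

/-! ### Types -/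

/-- Precomposition with multiplication by `i`. -/
def compI : (ℂ →L[ℝ] ℂ) →L[ℝ] (ℂ →L[ℝ] ℂ) :=
  (ContinuousLinearMap.compL ℝ ℂ ℂ ℂ).flip (Complex.I • ContinuousLinearMap.id ℝ ℂ : ℂ →L[ℝ] ℂ)

theorem hodgeStar_inChart (α : OneForm M) {e : OpenPartialHomeomorph M ℂ} (he : e ∈ atlas ℂ M)
    {z : ℂ} (hz : z ∈ e.target) : (hodgeStar α).inChart e z = -compI (α.inChart e z) := by
  ext1 v
  rw [OneForm.inChart_eq, ContinuousLinearMap.comp_apply, hodgeStar_coord,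
    ← chartDeriv_smul_I he hz]
  rfl

theorem part01_inChart (α : OneForm M) {e : OpenPartialHomeomorph M ℂ} (he : e ∈ atlas ℂ M)
    {z : ℂ} (hz : z ∈ e.target) :
    OneForm.inChart (fun y => part01 (α y)) e z =
      (1 / 2 : ℂ) • (α.inChart e z + Complex.I • compI (α.inChart e z)) := by
  ext1 v
  rw [OneForm.inChart_eq, ContinuousLinearMap.comp_apply, part01_coord,
    ← chartDeriv_smul_I he hz]
  rfl

theorem OneForm.IsSmooth.hodgeStar {α : OneForm M} (h : α.IsSmooth) :
    (hodgeStar α).IsSmooth := fun e he =>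
  (compI.contDiff.comp_contDiffOn (h e he)).neg.congr fun _ hz => hodgeStar_inChart α he hz

theorem OneForm.IsSmooth.part01 {α : OneForm M} (h : α.IsSmooth) :
    OneForm.IsSmooth (fun y => part01 (α y)) := fun e he =>
  (((h e he).add ((compI.contDiff.comp_contDiffOn (h e he)).const_smul Complex.I)).const_smul
    (1 / 2 : ℂ)).congr fun _ hz => part01_inChart α he hz

theorem extD_re_eq_zero {α : OneForm M} (h : α.IsSmooth) (hi : α.IsImaginary) (x : M) :
    (TwoForm.coord (extD α) x ![1, Complex.I]).re = 0 := by
  have hd := h.diffAt x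
  have key : ∀ v w, (fderiv ℝ (α.inChart (chartAt ℂ x)) (chartAt ℂ x x) v w).re = 0 := by
    intro v w
    have h1 : HasFDerivAt (fun z => (α.inChart (chartAt ℂ x) z w).re)
        ((Complex.reCLM.comp (ContinuousLinearMap.apply ℝ ℂ w)).comp
          (fderiv ℝ (α.inChart (chartAt ℂ x)) (chartAt ℂ x x))) (chartAt ℂ x x) :=
      (Complex.reCLM.comp (ContinuousLinearMap.apply ℝ ℂ w)).hasFDerivAt.comp _
        (DifferentiableAt.hasFDerivAt hd)
    have h2 : (fun z => (α.inChart (chartAt ℂ x) z w).re) = fun _ => (0 : ℝ) := by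
      ext z; exact hi _ _
    rw [h2] at h1
    exact (congrArg (fun f : ℂ →L[ℝ] ℝ => f v) ((hasFDerivAt_const _ _).unique h1)).symm
  rw [extD_coord_apply hd, Complex.sub_re, key, key, sub_zero]

end ExteriorDerivative

/-! ### Compactly supported functions and integration by parts on a vector space -/

section Plane

open MeasureTheory

theorem integrableOn_of_eq_zero_off_compact {E F : Type*} [TopologicalSpace E]
    [MeasurableSpace E] [OpensMeasurableSpace E] [T2Space E] [TopologicalSpace.PseudoMetrizableSpace E]
    {μ : Measure E} [IsFiniteMeasureOnCompacts μ] [NormedAddCommGroup F]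
    {g : E → F} {U K : Set E} (hU : IsOpen U) (hK : IsCompact K)
    (hKU : K ⊆ U) (hg : ContinuousOn g U) (h0 : ∀ z ∈ U, z ∉ K → g z = 0) :
    IntegrableOn g U μ :=
  ((hg.mono hKU).integrableOn_compact hK).of_forall_sdiff_eq_zero hU.measurableSet
    fun z hz => h0 z hz.1 hz.2

/-- `U` and the complement of `K` are open and cover the space; the extension by zero is `g` on the
first and zero on the second. -/
theorem contDiff_indicator {E F : Type*} [NormedAddCommGroup E] [NormedSpace ℝ E]
    [NormedAddCommGroup F] [NormedSpace ℝ F] {g : E → F} {U K : Set E} {n : ℕ∞ω}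
    (hU : IsOpen U) (hK : IsClosed K) (hKU : K ⊆ U) (hg : ContDiffOn ℝ n g U)
    (h0 : ∀ z ∈ U, z ∉ K → g z = 0) : ContDiff ℝ n (U.indicator g) := by
  rw [contDiff_iff_contDiffAt]
  intro z
  by_cases hz : z ∈ U
  · refine (hg.contDiffAt (hU.mem_nhds hz)).congr_of_eventuallyEq ?_
    filter_upwards [hU.mem_nhds hz] with w hw
    exact indicator_of_mem hw g
  · refine (contDiffAt_const (c := (0 : F))).congr_of_eventuallyEq ?_
    filter_upwards [hK.isOpen_compl.mem_nhds fun h => hz (hKU h)] with w hw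
    by_cases hwU : w ∈ U
    · rw [indicator_of_mem hwU, h0 w hwU hw]
    · exact indicator_of_notMem hwU g

/-- Integration by parts against the constant function `1`, whose derivative vanishes. -/
theorem integral_fderiv_eq_zero {E F : Type*} [NormedAddCommGroup E] [NormedSpace ℝ E]
    [FiniteDimensional ℝ E] [MeasurableSpace E] [BorelSpace E] {μ : Measure E}
    [μ.IsAddHaarMeasure] [NormedAddCommGroup F] [NormedSpace ℝ F]
    {g : E → F} (hg : ContDiff ℝ 1 g) (hc : HasCompactSupport g) (v : E) :
    ∫ z, fderiv ℝ g z v ∂μ = 0 := by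
  have hi : Integrable (fun z => fderiv ℝ g z v) μ :=
    ((hg.continuous_fderiv one_ne_zero).clm_apply continuous_const).integrable_of_hasCompactSupport
      (hc.fderiv_apply ℝ v)
  have h := integral_smul_fderiv_eq_neg_fderiv_smul_of_integrable (μ := μ) (𝕜 := ℝ)
    (f := fun _ => (1 : ℝ)) (g := g) (v := v) (by simp) (by simpa using hi)
    (by simpa using hg.continuous.integrable_of_hasCompactSupport hc)
    (fun _ _ => differentiableAt_const _) (fun z _ => hg.differentiable one_ne_zero z)
  simpa using h

theorem det_eq_re_im (f : ℂ →L[ℝ] ℂ) :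
    f.det = (f 1).re * (f Complex.I).im - (f 1).im * (f Complex.I).re := by
  rw [ContinuousLinearMap.det, ← LinearMap.det_toMatrix Complex.basisOneI, Matrix.det_fin_two]
  simp [LinearMap.toMatrix_apply]
  ring

end Plane

/-! ### Chart independence of the integral and Stokes' theorem -/

section Integral

open MeasureTheory

variable {M : Type*} [TopologicalSpace M] [ChartedSpace ℂ M]

/-- The density of a `2`-form in a chart. -/
def TwoForm.density (τ : TwoForm M) (e : OpenPartialHomeomorph M ℂ) (z : ℂ) : ℂ :=
  τ.inChart e z ![1, Complex.I]

theorem TwoForm.density_add (τ τ' : TwoForm M) (e : OpenPartialHomeomorph M ℂ) (z : ℂ) :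
    TwoForm.density (fun x => τ x + τ' x) e z = τ.density e z + τ'.density e z := rfl

theorem TwoForm.density_smul (f : M → ℂ) (τ : TwoForm M) (e : OpenPartialHomeomorph M ℂ) (z : ℂ) :
    TwoForm.density (fun x => f x • τ x) e z = f (e.symm z) * τ.density e z := rfl

theorem TwoForm.density_eq_zero {τ : TwoForm M} {e : OpenPartialHomeomorph M ℂ} {z : ℂ}
    (h : τ (e.symm z) = 0) : τ.density e z = 0 := by
  have h1 : TwoForm.coord τ (e.symm z) = 0 := h
  rw [TwoForm.density, TwoForm.inChart_eq, h1]
  rfl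

/-- A `2`-form is smooth in density if its density in every chart is smooth. -/
def TwoForm.DensitySmooth (τ : TwoForm M) : Prop :=
  ∀ e ∈ atlas ℂ M, ContDiffOn ℝ ∞ (τ.density e) e.target

theorem TwoForm.IsSmooth.densitySmooth {τ : TwoForm M} (h : τ.IsSmooth) : τ.DensitySmooth :=
  fun _ he => TwoForm.contDiffOn_apply h he _

theorem TwoForm.DensitySmooth.add {τ τ' : TwoForm M} (h : τ.DensitySmooth)
    (h' : τ'.DensitySmooth) : TwoForm.DensitySmooth (fun x => τ x + τ' x) :=
  fun e he => (h e he).add (h' e he)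

variable [IsManifold 𝓘(ℂ) ω M]

/-- The integral sees only the density of a `2`-form, and that of `extD α` is a difference of first
derivatives of `α` in the same chart. -/
theorem OneForm.IsSmooth.extD_densitySmooth {α : OneForm M} (h : α.IsSmooth) :
    (extD α).DensitySmooth := fun _ he => extD_contDiffOn h he

theorem TwoForm.DensitySmooth.smul {τ : TwoForm M} {f : M → ℂ}
    (hf : ContMDiff 𝓘(ℝ, ℂ) 𝓘(ℝ, ℂ) ∞ f) (h : τ.DensitySmooth) :
    TwoForm.DensitySmooth (fun x => f x • τ x) :=
  fun e he => (contDiffOn_comp_symm hf he).mul (h e he)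

/-- The Jacobian determinant of a holomorphic map is `|f'|² ≥ 0`, so the absolute value in the
change of variables formula costs no sign. -/
theorem TwoForm.density_transition (τ : TwoForm M) {e e' : OpenPartialHomeomorph M ℂ}
    (he : e ∈ atlas ℂ M) (he' : e' ∈ atlas ℂ M) {z : ℂ} (hz : z ∈ e.target)
    (h : e.symm z ∈ e'.source) :
    τ.density e z =
      |(fderiv ℝ (e' ∘ e.symm) z).det| • τ.density e' (e' (e.symm z)) := by
  have hm := mem_transition hz h
  have e1 : τ.density e z = τ.inChart e' (e' (e.symm z))
      ![fderiv ℝ (e' ∘ e.symm) z 1, fderiv ℝ (e' ∘ e.symm) z Complex.I] := by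
    rw [TwoForm.density, TwoForm.inChart_comp τ he he' hz h]
    refine congrArg (τ.inChart e' (e' (e.symm z))) ?_
    ext i; fin_cases i <;> rfl
  have hdet : 0 ≤ (fderiv ℝ (e' ∘ e.symm) z).det := by
    rw [det_eq_re_im, fderiv_transition_apply he he' hm, fderiv_transition_apply he he' hm]
    simp only [mul_one, Complex.mul_im, Complex.I_im, Complex.I_re, Complex.mul_re, mul_zero,
      zero_sub, add_zero, mul_neg, sub_neg_eq_add]
    exact add_nonneg (mul_self_nonneg _) (mul_self_nonneg _)
  rw [e1, alternating_apply_eq_det, abs_of_nonneg hdet, det_eq_re_im, Complex.real_smul]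
  rfl

variable [T2Space M] [CompactSpace M]

theorem tsupport_chartPartition_subset (c : M) :
    tsupport (chartPartition M c) ⊆ (chartAt ℂ c).source :=
  (SmoothPartitionOfUnity.exists_isSubordinate_chartAt_source 𝓘(ℝ, ℂ) M).choose_spec c

variable (M) in
/-- The finite set of the indices of the nonzero members of the partition of unity. -/
def partitionIndices : Finset M :=
  ((chartPartition M).locallyFinite.finite_nonempty_of_compact).toFinset

theorem chartPartition_eq_zero {c : M} (hc : c ∉ partitionIndices M) (x : M) :
    chartPartition M c x = 0 := by
  by_contra h
  exact hc ((Set.Finite.mem_toFinset _).2 ⟨x, h⟩)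

theorem sum_chartPartition (x : M) : ∑ c ∈ partitionIndices M, chartPartition M c x = 1 := by
  rw [← (chartPartition M).sum_eq_one (mem_univ x)]
  refine (finsum_eq_sum_of_support_subset _ fun c hc => ?_).symm
  by_contra h
  exact hc (chartPartition_eq_zero h x)

/-- The members of the partition of unity as complex valued functions. -/
def cutoff (c : M) (x : M) : ℂ := chartPartition M c x

theorem cutoff_contMDiff (c : M) : ContMDiff 𝓘(ℝ, ℂ) 𝓘(ℝ, ℂ) ∞ (cutoff c) :=
  Complex.ofRealCLM.contMDiff.comp (chartPartition M c).contMDiff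

theorem sum_cutoff (x : M) : ∑ c ∈ partitionIndices M, cutoff c x = 1 := by
  unfold cutoff
  rw [← Complex.ofReal_sum, sum_chartPartition, Complex.ofReal_one]

theorem cutoff_eq_zero {c x : M} (h : x ∉ tsupport (chartPartition M c)) : cutoff c x = 0 := by
  rw [cutoff, image_eq_zero_of_notMem_tsupport h, Complex.ofReal_zero]

theorem integral_eq_sum (τ : TwoForm M) :
    integral τ = ∑ c ∈ partitionIndices M, ∫ z in (chartAt ℂ c).target,
      cutoff c ((chartAt ℂ c).symm z) * τ.density (chartAt ℂ c) z := by
  refine finsum_eq_sum_of_support_subset _ fun c hc => ?_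
  by_contra h
  refine hc ?_
  simp [chartPartition_eq_zero (M := M) h]

theorem integrableOn_cutoff_mul {τ : TwoForm M} (h : τ.DensitySmooth) (c : M) :
    IntegrableOn (fun z => cutoff c ((chartAt ℂ c).symm z) * τ.density (chartAt ℂ c) z)
      (chartAt ℂ c).target := by
  set e := chartAt ℂ c
  have he : e ∈ atlas ℂ M := chart_mem_atlas ℂ c
  have hs := tsupport_chartPartition_subset c
  refine integrableOn_of_eq_zero_off_compact e.open_target
    ((isClosed_tsupport (chartPartition M c)).isCompact.image_of_continuousOn
      (e.continuousOn.mono hs)) ?_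
    ((contDiffOn_comp_symm (cutoff_contMDiff c) he).continuousOn.mul (h e he).continuousOn) ?_
  · rintro _ ⟨x, hx, rfl⟩
    exact e.map_source (hs hx)
  · intro z hz hzK
    have : e.symm z ∉ tsupport (chartPartition M c) := fun hx => hzK ⟨_, hx, e.right_inv hz⟩
    simp [cutoff_eq_zero this]

theorem integral_add {τ τ' : TwoForm M} (h : τ.DensitySmooth) (h' : τ'.DensitySmooth) :
    integral (fun x => τ x + τ' x) = integral τ + integral τ' := by
  rw [integral_eq_sum, integral_eq_sum, integral_eq_sum, ← Finset.sum_add_distrib]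
  refine Finset.sum_congr rfl fun c _ => ?_
  rw [← MeasureTheory.integral_add (integrableOn_cutoff_mul h c) (integrableOn_cutoff_mul h' c)]
  refine integral_congr_ae (Filter.Eventually.of_forall fun z => ?_)
  simp only [TwoForm.density_add, mul_add]

theorem integral_zero : integral (fun _ => 0 : TwoForm M) = 0 := by
  rw [integral_eq_sum]
  refine Finset.sum_eq_zero fun c _ => ?_
  simp [TwoForm.density_eq_zero]

/-- The integral of a form with support in the domain of one chart may be computed there. -/
theorem integral_eq_of_support {τ : TwoForm M} (h : τ.DensitySmooth)
    {e : OpenPartialHomeomorph M ℂ} (he : e ∈ atlas ℂ M) {K : Set M} (hK : IsCompact K)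
    (hKe : K ⊆ e.source) (h0 : ∀ x ∉ K, τ x = 0) :
    integral τ = ∫ z in e.target, τ.density e z := by
  -- Both sides reduce to the overlap of the two charts: the left because `τ` vanishes off `K`, the
  -- right because the cutoff vanishes off the chart at `c`. There the change of variables formula
  -- applies.
  have key : ∀ c : M, ∫ z in (chartAt ℂ c).target,
      cutoff c ((chartAt ℂ c).symm z) * τ.density (chartAt ℂ c) z =
      ∫ z in e.target, cutoff c (e.symm z) * τ.density e z := by
    intro c
    set k := chartAt ℂ c with hk
    have hka : k ∈ atlas ℂ M := chart_mem_atlas ℂ c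
    have e1 : ∫ z in k.target, cutoff c (k.symm z) * τ.density k z =
        ∫ z in (k.symm ≫ₕ e).source, cutoff c (k.symm z) * τ.density k z := by
      refine setIntegral_eq_of_subset_of_forall_sdiff_eq_zero k.open_target.measurableSet
        (fun z hz => ?_) fun z hz => ?_
      · exact (show z ∈ k.target ∧ _ by simpa using hz).1
      · have : k.symm z ∉ K := fun hx => hz.2 (mem_transition hz.1 (hKe hx))
        rw [TwoForm.density_eq_zero (h0 _ this), mul_zero]
    have e2 : ∫ z in e.target, cutoff c (e.symm z) * τ.density e z =
        ∫ z in (k.symm ≫ₕ e) '' (k.symm ≫ₕ e).source,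
          cutoff c (e.symm z) * τ.density e z := by
      rw [(k.symm ≫ₕ e).image_source_eq_target]
      refine setIntegral_eq_of_subset_of_forall_sdiff_eq_zero e.open_target.measurableSet
        (fun z hz => ?_) fun z hz => ?_
      · exact (show z ∈ e.target ∧ _ by simpa using hz).1
      · have : e.symm z ∉ tsupport (chartPartition M c) := fun hx => hz.2 (by
          simpa using And.intro hz.1 (tsupport_chartPartition_subset c hx))
        rw [cutoff_eq_zero this, zero_mul]
    rw [e1, e2, integral_image_eq_integral_abs_det_fderiv_smul (f := k.symm ≫ₕ e)
      (f' := fun z => fderiv ℝ (e ∘ k.symm) z) volume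
      (k.symm ≫ₕ e).open_source.measurableSet
      (fun z hz => (((contDiffAt_transition hka he hz).differentiableAt
        (by simp)).hasFDerivAt.hasFDerivWithinAt)) (k.symm ≫ₕ e).injOn]
    refine setIntegral_congr_fun (k.symm ≫ₕ e).open_source.measurableSet fun z hz => ?_
    have hz' : z ∈ k.target ∧ k.symm z ∈ e.source := by simpa using hz
    have hl : e.symm ((k.symm ≫ₕ e) z) = k.symm z := by simp [e.left_inv hz'.2]
    simp only [hl]
    rw [TwoForm.density_transition τ hka he hz'.1 hz'.2, mul_smul_comm]
    rfl
  rw [integral_eq_sum, Finset.sum_congr rfl fun c _ => key c, ← integral_finsetSum]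
  · refine integral_congr_ae (Filter.Eventually.of_forall fun z => ?_)
    simp only [← Finset.sum_mul, sum_cutoff, one_mul]
  · intro c _
    refine integrableOn_of_eq_zero_off_compact e.open_target
      (hK.image_of_continuousOn (e.continuousOn.mono hKe)) ?_
      ((contDiffOn_comp_symm (cutoff_contMDiff c) he).continuousOn.mul (h e he).continuousOn) ?_
    · rintro _ ⟨x, hx, rfl⟩
      exact e.map_source (hKe hx)
    · intro z hz hzK
      have : e.symm z ∉ K := fun hx => hzK ⟨_, hx, e.right_inv hz⟩
      simp [TwoForm.density_eq_zero (h0 _ this)]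

/-- In the chart the form extends by zero to a smooth compactly supported form on `ℂ`, and each of
the two partial derivatives in its exterior derivative integrates to zero. -/
theorem integral_extD_of_support {α : OneForm M} (h : α.IsSmooth)
    {e : OpenPartialHomeomorph M ℂ} (he : e ∈ atlas ℂ M) {K : Set M} (hK : IsCompact K)
    (hKe : K ⊆ e.source) (h0 : ∀ x ∉ K, α x = 0) : integral (extD α) = 0 := by
  have hd0 : ∀ x ∉ K, extD α x = 0 := by
    intro x hx
    have h1 : extD α x = extD (fun y => (0 : ℂ) • α y) x :=
      extD_congr (by
        filter_upwards [hK.isClosed.isOpen_compl.mem_nhds hx] with y hy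
        rw [h0 y hy]
        exact (zero_smul ℂ (0 : ℂ →L[ℝ] ℂ)).symm)
    rw [h1, extD_const_smul 0 (h.diffAt x)]
    exact zero_smul ℂ (TwoForm.coord (extD α) x)
  set K' := e '' K
  have hK' : IsCompact K' := hK.image_of_continuousOn (e.continuousOn.mono hKe)
  have hKt : K' ⊆ e.target := by
    rintro _ ⟨x, hx, rfl⟩
    exact e.map_source (hKe hx)
  have hz0 : ∀ z ∈ e.target, z ∉ K' → α.inChart e z = 0 := by
    intro z hz hzK
    have h1 : OneForm.coord α (e.symm z) = 0 := h0 _ fun hx => hzK ⟨_, hx, e.right_inv hz⟩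
    rw [OneForm.inChart_eq, h1]
    rfl
  set θ := e.target.indicator (α.inChart e) with hθ
  have hθs : ContDiff ℝ ∞ θ := contDiff_indicator e.open_target hK'.isClosed hKt (h e he) hz0
  have hθ0 : ∀ z ∉ K', θ z = 0 := by
    intro z hz
    by_cases hzt : z ∈ e.target
    · rw [hθ, indicator_of_mem hzt, hz0 z hzt hz]
    · exact indicator_of_notMem hzt _
  have hθc : HasCompactSupport θ := HasCompactSupport.intro hK' hθ0
  have hev : ∀ z ∈ e.target, fderiv ℝ (α.inChart e) z = fderiv ℝ θ z := by
    intro z hz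
    refine Filter.EventuallyEq.fderiv_eq ?_
    filter_upwards [e.open_target.mem_nhds hz] with w hw
    rw [hθ, indicator_of_mem hw]
  have hw : ∀ v w, ∫ z, fderiv ℝ θ z v w = 0 := by
    intro v w
    have h1 := integral_fderiv_eq_zero (μ := (volume : Measure ℂ)) (g := fun z => θ z w)
      ((hθs.of_le (by simp)).clm_apply contDiff_const)
      (HasCompactSupport.intro hK' fun z hz => by simp [hθ0 z hz]) v
    rw [← h1]
    refine integral_congr_ae (Filter.Eventually.of_forall fun z => ?_)
    simp only
    rw [fderiv_clm_apply (hθs.differentiable (by simp) z) (differentiableAt_const w)]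
    simp
  have hi : ∀ v w, Integrable (fun z => fderiv ℝ θ z v w) := by
    intro v w
    refine (((hθs.continuous_fderiv (by simp)).clm_apply continuous_const).clm_apply
      continuous_const).integrable_of_hasCompactSupport
      (HasCompactSupport.intro hK' fun z hz => ?_)
    have : θ =ᶠ[𝓝 z] fun _ => 0 := by
      filter_upwards [hK'.isClosed.isOpen_compl.mem_nhds hz] with y hy
      exact hθ0 y hy
    rw [this.fderiv_eq]
    simp
  rw [integral_eq_of_support h.extD_densitySmooth he hK hKe hd0]
  have e1 : ∀ z ∈ e.target, (extD α).density e z =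
      fderiv ℝ θ z 1 Complex.I - fderiv ℝ θ z Complex.I 1 := by
    intro z hz
    rw [TwoForm.density, extD_inChart_apply h he hz, hev z hz]
  rw [setIntegral_congr_fun e.open_target.measurableSet e1,
    setIntegral_eq_integral_of_forall_compl_eq_zero, integral_sub (hi _ _) (hi _ _), hw, hw,
    sub_zero]
  intro z hz
  have hzK : z ∉ K' := fun h' => hz (hKt h')
  have : θ =ᶠ[𝓝 z] fun _ => 0 := by
    filter_upwards [hK'.isClosed.isOpen_compl.mem_nhds hzK] with y hy
    exact hθ0 y hy
  rw [this.fderiv_eq]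
  simp

/-- Stokes' theorem on a compact Riemann surface. -/
theorem integral_extD {α : OneForm M} (h : α.IsSmooth) : integral (extD α) = 0 := by
  -- Induction on finite partial sums of the partition of unity, each new summand being supported in
  -- one chart. Smoothness is carried along because additivity of the integral needs it; the full
  -- sum gives back `α`.
  have key : ∀ S : Finset M,
      OneForm.IsSmooth (fun x => (∑ c ∈ S, cutoff c x) • α x) ∧
        integral (extD fun x => (∑ c ∈ S, cutoff c x) • α x) = 0 := by
    classical
    intro S
    induction S using Finset.induction_on with
    | empty =>
      have h1 : (fun x => (∑ c ∈ (∅ : Finset M), cutoff c x) • α x) =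
          fun x => (0 : ℂ) • α x := by simp
      rw [h1]
      refine ⟨h.const_smul 0, ?_⟩
      rw [show extD (fun x => (0 : ℂ) • α x) = fun _ => 0 from funext fun x => by
        rw [extD_const_smul 0 (h.diffAt x)]
        exact zero_smul ℂ (TwoForm.coord (extD α) x), integral_zero]
    | insert c S hc ih =>
      have hcs := h.smul (cutoff_contMDiff c)
      have h1 : (fun x => (∑ c ∈ insert c S, cutoff c x) • α x) =
          fun x => cutoff c x • α x + (∑ c ∈ S, cutoff c x) • α x := by
        ext x : 1
        rw [Finset.sum_insert hc]
        exact add_smul _ _ (OneForm.coord α x)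
      rw [h1]
      refine ⟨hcs.add ih.1, ?_⟩
      rw [show extD (fun x => cutoff c x • α x + (∑ c ∈ S, cutoff c x) • α x) =
        fun x => extD (fun x => cutoff c x • α x) x +
          extD (fun x => (∑ c ∈ S, cutoff c x) • α x) x from
        funext fun x => extD_add (hcs.diffAt x) (ih.1.diffAt x),
        integral_add hcs.extD_densitySmooth ih.1.extD_densitySmooth, ih.2, add_zero]
      exact integral_extD_of_support hcs (chart_mem_atlas ℂ c)
        (isClosed_tsupport (chartPartition M c)).isCompact (tsupport_chartPartition_subset c)
        fun x hx => by
          rw [cutoff_eq_zero hx]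
          exact zero_smul ℂ (OneForm.coord α x)
  have h1 := (key (partitionIndices M)).2
  simpa only [sum_cutoff, one_smul] using h1

end Integral

/-! ### Positivity of integrals against an area form -/

section Positivity

open MeasureTheory

variable {M : Type*} [TopologicalSpace M] [ChartedSpace ℂ M]

theorem IsAreaForm.coord_re_pos {area : TwoForm M} (h : IsAreaForm area) (x : M) {v : ℂ}
    (hv : v ≠ 0) : 0 < (TwoForm.coord area x ![v, Complex.I * v]).re := h.pos x v hv

theorem IsAreaForm.coord_im {area : TwoForm M} (h : IsAreaForm area) (x : M) (v : Fin 2 → ℂ) :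
    (TwoForm.coord area x v).im = 0 := h.real x v

theorem IsAreaForm.density_eq {area : TwoForm M} (h : IsAreaForm area)
    (e : OpenPartialHomeomorph M ℂ) (z : ℂ) :
    area.density e z = ((area.density e z).re : ℂ) :=
  Complex.ext rfl (h.real _ _)

variable [IsManifold 𝓘(ℂ) ω M]

theorem IsAreaForm.density_re_pos {area : TwoForm M} (h : IsAreaForm area)
    {e : OpenPartialHomeomorph M ℂ} (he : e ∈ atlas ℂ M) {z : ℂ} (hz : z ∈ e.target) :
    0 < (area.density e z).re := by
  have e1 : area.density e z = TwoForm.coord area (e.symm z)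
      ![chartDeriv e z 1, Complex.I * chartDeriv e z 1] := by
    rw [TwoForm.density, TwoForm.inChart_eq, ← chartDeriv_smul_I he hz]
    refine congrArg (TwoForm.coord area (e.symm z)) ?_
    ext i; fin_cases i <;> simp
  rw [e1]
  refine h.coord_re_pos _ fun h0 => one_ne_zero (chartDeriv_injective he hz ?_)
  rw [h0, map_zero]

variable [T2Space M] [CompactSpace M]

/-- Every chart integrand `ρ_c f area` is nonnegative, so each chart integral vanishes separately.
Each integrand is then zero almost everywhere, hence everywhere by continuity, and a chart with `ρ_c
x > 0` gives `f x = 0`. -/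
theorem integral_area_smul_eq_zero {area : TwoForm M} (h : IsAreaForm area) {f : M → ℝ}
    (hf : ContMDiff 𝓘(ℝ, ℂ) 𝓘(ℝ, ℂ) ∞ (fun x => (f x : ℂ))) (hn : ∀ x, 0 ≤ f x)
    (h0 : (integral (fun x => (f x : ℂ) • area x)).re = 0) (x : M) : f x = 0 := by
  let g : M → ℂ → ℝ := fun c z => chartPartition M c ((chartAt ℂ c).symm z) *
    (f ((chartAt ℂ c).symm z) * (area.density (chartAt ℂ c) z).re)
  have hg : ∀ c z, cutoff c ((chartAt ℂ c).symm z) *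
      TwoForm.density (fun x => (f x : ℂ) • area x) (chartAt ℂ c) z = (g c z : ℂ) := by
    intro c z
    rw [TwoForm.density_smul, h.density_eq]
    simp [g, cutoff]
  have hsm : TwoForm.DensitySmooth (fun x => (f x : ℂ) • area x) := h.smooth.densitySmooth.smul hf
  have hgn : ∀ c, ∀ z ∈ (chartAt ℂ c).target, 0 ≤ g c z := fun c z hz =>
    mul_nonneg ((chartPartition M).nonneg _ _)
      (mul_nonneg (hn _) (h.density_re_pos (chart_mem_atlas ℂ c) hz).le)
  have hsum : ∑ c ∈ partitionIndices M, ∫ z in (chartAt ℂ c).target, g c z = 0 := by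
    rw [integral_eq_sum] at h0
    simp only [hg, integral_complex_ofReal] at h0
    simpa using h0
  have hint : ∀ c, ∫ z in (chartAt ℂ c).target, g c z = 0 := by
    intro c
    by_cases hc : c ∈ partitionIndices M
    · exact (Finset.sum_eq_zero_iff_of_nonneg fun c _ =>
        setIntegral_nonneg (chartAt ℂ c).open_target.measurableSet (hgn c)).1 hsum c hc
    · simp [g, chartPartition_eq_zero hc]
  obtain ⟨c, hc⟩ := (chartPartition M).exists_pos_of_mem (mem_univ x)
  set e := chartAt ℂ c with he
  have hxe : x ∈ e.source := tsupport_chartPartition_subset c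
    (subset_tsupport _ (Function.mem_support.2 hc.ne'))
  have hcont : ContinuousOn (g c) e.target := by
    have h1 : ContinuousOn (fun z => (g c z : ℂ)) e.target :=
      (((contDiffOn_comp_symm (cutoff_contMDiff c) (chart_mem_atlas ℂ c)).mul
        (hsm e (chart_mem_atlas ℂ c))).continuousOn).congr fun z _ => (hg c z).symm
    exact Complex.continuous_re.comp_continuousOn h1
  have hgi : IntegrableOn (g c) e.target := by
    have h1 := (integrableOn_cutoff_mul hsm c).re
    refine h1.congr (Filter.Eventually.of_forall fun z => ?_)
    simp only [hg]
    rfl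
  have hae : g c =ᵐ[volume.restrict e.target] fun _ => 0 :=
    (setIntegral_eq_zero_iff_of_nonneg_ae
      ((ae_restrict_iff' e.open_target.measurableSet).2 (Filter.Eventually.of_forall (hgn c)))
      hgi).1 (hint c)
  have hz := Measure.eqOn_open_of_ae_eq hae e.open_target hcont continuousOn_const
    (e.map_source hxe)
  have hp := h.density_re_pos (chart_mem_atlas ℂ c) (e.map_source hxe)
  simp only [g] at hz
  rw [← he, e.left_inv hxe] at hz
  exact (mul_eq_zero.1 ((mul_eq_zero.1 hz).resolve_left hc.ne')).resolve_right hp.ne'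

end Positivity

/-! ### Sections, connection forms and local frames -/

section Sections

theorem part01_add_smul_apply {M : Type*} [TopologicalSpace M] [ChartedSpace ℂ M] {x : M}
    (η θ : TangentSpace 𝓘(ℝ, ℂ) x →L[ℝ] ℂ) (t : ℝ) (v : TangentSpace 𝓘(ℝ, ℂ) x) :
    part01 (η + t • θ) v = part01 η v + t * part01 θ v := by
  have e3 : ∀ η : TangentSpace 𝓘(ℝ, ℂ) x →L[ℝ] ℂ, part01 η v =
    (1 / 2 : ℂ) * (η v + Complex.I * η (tangentJ x v)) := fun _ => rfl
  have e5 : ∀ w, (η + t • θ) w = η w + (t : ℂ) * θ w := fun _ => rfl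
  rw [e3, e3, e3, e5, e5]
  ring

theorem I_smul_apply {M : Type*} [TopologicalSpace M] [ChartedSpace ℂ M] {x : M}
    (η : TangentSpace 𝓘(ℝ, ℂ) x →L[ℝ] ℂ) (v : TangentSpace 𝓘(ℝ, ℂ) x) :
    (Complex.I • η) v = Complex.I * η v := rfl

variable {M : Type*} [TopologicalSpace M] [ChartedSpace ℂ M]
  {L : M → Type*} [∀ x, NormedAddCommGroup (L x)] [∀ x, InnerProductSpace ℂ (L x)]
  [TopologicalSpace (TotalSpace ℂ L)] [FiberBundle ℂ L] [VectorBundle ℂ ℂ L]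

theorem trivializationAt_snd_smul (x₀ : M) {x : M} (hx : x ∈ (trivializationAt ℂ L x₀).baseSet)
    (c : ℂ) (v : L x) :
    (trivializationAt ℂ L x₀ ⟨x, c • v⟩).2 = c * (trivializationAt ℂ L x₀ ⟨x, v⟩).2 := by
  have := VectorBundle.trivialization_linear' (R := ℂ) (trivializationAt ℂ L x₀)
  exact (this.linear x hx).map_smul c v

theorem Sec.IsSmooth.const_smul {s : Sec L} (hs : s.IsSmooth) (c : ℂ) :
    Sec.IsSmooth (fun x => c • s x) := by
  intro x₀
  have h := (contMDiffAt_section (IB := 𝓘(ℝ, ℂ)) (n := ∞) x₀).1 (hs x₀)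
  refine (contMDiffAt_section (IB := 𝓘(ℝ, ℂ)) (n := ∞) x₀).2 ?_
  have h2 : ContMDiffAt 𝓘(ℝ, ℂ) 𝓘(ℝ, ℂ) ∞
      (fun x => c * (trivializationAt ℂ L x₀ ⟨x, s x⟩).2) x₀ :=
    ((ContinuousLinearMap.mul ℝ ℂ c).contMDiff).contMDiffAt.comp x₀ h
  refine h2.congr_of_eventuallyEq ?_
  filter_upwards [(trivializationAt ℂ L x₀).open_baseSet.mem_nhds
    (mem_baseSet_trivializationAt ℂ L x₀)] with x hx
  exact trivializationAt_snd_smul x₀ hx c (s x)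

theorem Sec.IsSmooth.mdifferentiableAt {s : Sec L} (hs : s.IsSmooth) (x : M) :
    MDifferentiableAt 𝓘(ℝ, ℂ) (𝓘(ℝ, ℂ).prod 𝓘(ℝ, ℂ)) (fun y => TotalSpace.mk' ℂ y (s y)) x :=
  (hs x).mdifferentiableAt (by simp)

theorem conn_add_smul (A : CovariantDerivative 𝓘(ℝ, ℂ) ℂ L) {s s' : Sec L} (hs : s.IsSmooth)
    (hs' : s'.IsSmooth) (t : ℝ) (x : M) :
    A (fun y => s y + t • s' y) x = A s x + t • A s' x := by
  have h := A.isCovariantDerivativeOn (s := univ)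
  have h1 := h.smul_const t (hs'.mdifferentiableAt x)
  have h2 := h.add (hs.mdifferentiableAt x)
    (σ' := t • s') ((hs'.mdifferentiableAt x).smul_const_section)
  rw [h1] at h2
  exact h2

theorem delBar_I_smul {A : CovariantDerivative 𝓘(ℝ, ℂ) ℂ L} (hA : IsUnitary A) {s : Sec L}
    (hs : s.IsSmooth) (x : M) (v : TangentSpace 𝓘(ℝ, ℂ) x) :
    delBar A (fun y => Complex.I • s y) x v = Complex.I • delBar A s x v := by
  have e1 : ∀ r : Sec L, delBar A r x v =
    (1 / 2 : ℂ) • (A r x v + Complex.I • A r x (tangentJ x v)) := fun _ => rfl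
  rw [e1, e1, hA.complex_linear s x (hs.mdifferentiableAt x),
    hA.complex_linear s x (hs.mdifferentiableAt x)]
  module

theorem trivializationAt_clm_apply (x₀ : M) {x : M}
    (hx : x ∈ (trivializationAt ℂ L x₀).baseSet) (v : L x) :
    (trivializationAt ℂ L x₀).continuousLinearMapAt ℝ x v =
      (trivializationAt ℂ L x₀ ⟨x, v⟩).2 := by
  rw [Trivialization.continuousLinearMapAt_apply, Trivialization.coe_linearMapAt_of_mem _ hx]

variable (L) in
/-- The section with constant coordinate `1` in the preferred trivialization at `x₀`. -/
def unitFrame (x₀ : M) : Sec L := fun y => (trivializationAt ℂ L x₀).symm y 1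

theorem trivializationAt_unitFrame (x₀ : M) {x : M}
    (hx : x ∈ (trivializationAt ℂ L x₀).baseSet) :
    (trivializationAt ℂ L x₀ ⟨x, unitFrame L x₀ x⟩).2 = 1 := by
  rw [unitFrame, Trivialization.apply_mk_symm _ hx]

/-- In rank one the added endomorphism is a scalar, whatever the frame. Outside the base set the
frame means nothing, hence the restriction on `y`. -/
theorem connForm_addOneForm (A : CovariantDerivative 𝓘(ℝ, ℂ) ℂ L) (α : OneForm M) (x₀ : M) {y : M}
    (hy : y ∈ (trivializationAt ℂ L x₀).baseSet) :
    connForm (A.addOneForm (formEnd α)) x₀ y = connForm A x₀ y + α y := by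
  ext v
  have h1 : connForm (A.addOneForm (formEnd α)) x₀ y v =
    (trivializationAt ℂ L x₀).continuousLinearMapAt ℝ y
      (A (unitFrame L x₀) y v + α y v • unitFrame L x₀ y) := rfl
  have h2 : connForm A x₀ y v =
    (trivializationAt ℂ L x₀).continuousLinearMapAt ℝ y (A (unitFrame L x₀) y v) := rfl
  rw [h1, map_add, ← h2, trivializationAt_clm_apply x₀ hy (α y v • unitFrame L x₀ y),
    trivializationAt_snd_smul x₀ hy, trivializationAt_unitFrame x₀ hy, mul_one]
  rfl

variable [IsManifold 𝓘(ℂ) ω M] [ContMDiffVectorBundle ∞ ℂ L 𝓘(ℝ, ℂ)] [T2Space M]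

variable (L) in
-- The frame is smooth only over its base set, whereas smoothness of a connection is applied to
-- global sections. A bump function gives a global section with the same germ.
theorem exists_isSmooth_eq_unitFrame (x₀ : M) :
    ∃ s : Sec L, s.IsSmooth ∧ ∀ᶠ y in 𝓝 x₀, s y = unitFrame L x₀ y := by
  set T := trivializationAt ℂ L x₀ with hT
  have hb : T.baseSet ∈ 𝓝 x₀ := T.open_baseSet.mem_nhds (mem_baseSet_trivializationAt ℂ L x₀)
  obtain ⟨f, -, hf⟩ := (SmoothBumpFunction.nhds_basis_tsupport (I := 𝓘(ℝ, ℂ)) x₀).mem_iff.1 hb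
  refine ⟨fun y => f y • unitFrame L x₀ y, ?_, ?_⟩
  · have hsm : ContMDiffOn 𝓘(ℝ, ℂ) (𝓘(ℝ, ℂ).prod 𝓘(ℝ, ℂ)) ∞
        (fun y => TotalSpace.mk' ℂ y (unitFrame L x₀ y)) T.baseSet := by
      refine (T.contMDiffOn_section_baseSet_iff).2 ?_
      exact (contMDiffOn_const (c := (1 : ℂ))).congr fun y hy => trivializationAt_unitFrame x₀ hy
    exact ContMDiffOn.smul_section_of_tsupport f.contMDiff.contMDiffOn T.open_baseSet hf hsm
  · filter_upwards [f.eventuallyEq_one] with y hy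
    rw [hy]
    simp

/-- The covariant derivative of the cut-off frame is a smooth section of `Hom(TM, L)`. Its
coordinates in the preferred trivializations at `x` are, near `x`, the chart expression of the
connection form. -/
theorem connForm_diffAt (A : CovariantDerivative 𝓘(ℝ, ℂ) ℂ L)
    (hA : A.ContMDiffCovariantDerivative ∞) (x : M) : (connForm A x).DiffAt x := by
  obtain ⟨s, hs, hse⟩ := exists_isSmooth_eq_unitFrame L x
  have h1 := hA.contMDiff.contMDiff (σ := s) (hs.contMDiffOn)
  have h2 := ((contMDiffAt_hom_bundle _).1 (h1.contMDiffAt (x := x) Filter.univ_mem)).2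
  set c := chartAt ℂ x with hc
  have hx : x ∈ c.source := mem_chart_source ℂ x
  have hl : c.symm (c x) = x := c.left_inv hx
  have h3 : ContMDiffAt 𝓘(ℝ, ℂ) 𝓘(ℝ, ℂ) ∞ c.symm (c x) :=
    (contMDiffOn_symm_of_mem_maximalAtlas (I := 𝓘(ℝ, ℂ)) (n := ∞)
      (IsManifold.subset_maximalAtlas (chart_mem_atlas ℂ x))).contMDiffAt
      (c.open_target.mem_nhds (c.map_source hx))
  rw [← hl] at h2
  have h4 := (h2.comp (c x) h3).contDiffAt.differentiableAt (by simp)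
  rw [hl] at h4
  refine DifferentiableAt.congr_of_eventuallyEq h4 ?_
  have hT : ∀ᶠ y in 𝓝 x, (s y = unitFrame L x y ∧ ∀ᶠ y' in 𝓝 y, s y' = unitFrame L x y') :=
    hse.and (eventually_eventually_nhds.2 hse)
  have hcont : Filter.Tendsto c.symm (𝓝 (c x)) (𝓝 x) := by
    have := c.continuousAt_symm (c.map_source hx)
    rwa [ContinuousAt, hl] at this
  filter_upwards [hcont.eventually hT, c.open_target.mem_nhds (c.map_source hx)] with z hz hzt
  have hd : MDifferentiableAt 𝓘(ℝ, ℂ) (𝓘(ℝ, ℂ).prod 𝓘(ℝ, ℂ))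
      (fun y => TotalSpace.mk' ℂ y (unitFrame L x y)) (c.symm z) := by
    refine (hs.mdifferentiableAt _).congr_of_eventuallyEq ?_
    filter_upwards [hz.2] with y hy
    rw [hy]
  -- A covariant derivative depends only on the germ of the section.
  have hA' : A (unitFrame L x) (c.symm z) = A s (c.symm z) :=
    ((A.isCovariantDerivativeOn (s := univ)).congr_of_eventuallyEq (hs.mdifferentiableAt _) hd
      Filter.univ_mem hz.2).symm
  -- The inverse trivialization of the tangent bundle is the differential of the inverse chart,
  -- which occurs in `inChart`.
  have hsy := TangentBundle.symmL_trivializationAt (I := 𝓘(ℝ, ℂ)) (x₀ := x) (x := c.symm z)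
    (c.map_target hzt)
  have hsy' : ((trivializationAt ℂ (TangentSpace 𝓘(ℝ, ℂ)) x).symmL ℝ (c.symm z) :
      ℂ →L[ℝ] ℂ) = chartDeriv c (c (c.symm z)) := by
    rw [chartDeriv]
    simpa using! hsy
  rw [c.right_inv hzt] at hsy'
  have e1 : (connForm A x).inChart c z =
      (((trivializationAt ℂ L x).continuousLinearMapAt ℝ (c.symm z)).comp
        (A (unitFrame L x) (c.symm z))).comp (chartDeriv c z) := rfl
  rw [e1, ← hsy', hA']
  rfl

/-! ### The linearized equations -/

theorem hasDerivAt_quadratic {E : Type*} [NormedAddCommGroup E] [NormedSpace ℝ E] {f : ℝ → E}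
    {a b c : E} (hf : ∀ t, f t = a + t • b + t ^ 2 • c) : HasDerivAt f b 0 := by
  have h1 : HasDerivAt (fun t : ℝ => a + t • b + t ^ 2 • c)
      ((1 : ℝ) • b + (2 * (0 : ℝ) ^ (2 - 1) * 1) • c) 0 :=
    (((hasDerivAt_id (0 : ℝ)).smul_const b).const_add a).add
      (((hasDerivAt_id (0 : ℝ)).pow 2).smul_const c)
  rw [show f = fun t => a + t • b + t ^ 2 • c from funext hf]
  simpa using h1

/-- Each equation is a polynomial of degree at most two in `t` along `p + tX`, so its linearization
is the coefficient `b`. -/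
theorem hasDerivAt_quadratic_iff {E : Type*} [NormedAddCommGroup E] [NormedSpace ℝ E] {f : ℝ → E}
    {a b c : E} (hf : ∀ t, f t = a + t • b + t ^ 2 • c) : HasDerivAt f 0 0 ↔ b = 0 :=
  ⟨fun h0 => (hasDerivAt_quadratic hf).unique h0, fun h0 => h0 ▸ hasDerivAt_quadratic hf⟩

theorem norm_add_smul_sq {E : Type*} [NormedAddCommGroup E] [InnerProductSpace ℂ E] (a b : E)
    (t : ℝ) : ‖a + t • b‖ ^ 2 = ‖a‖ ^ 2 + t * (2 * (inner ℂ a b).re) + t ^ 2 * ‖b‖ ^ 2 := by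
  rw [norm_add_sq (𝕜 := ℂ), ← Complex.coe_smul, inner_smul_right, norm_smul, mul_pow]
  simp
  ring

/-- The structure group is abelian, so there is no term `α ∧ α` and the curvature is affine in the
connection. -/
theorem curvature_move {p : Config L} (hp : p.IsSmooth) {X : Variation L} (hX : X.IsSmooth)
    (t : ℝ) (x : M) :
    curvature (p.move X t).conn x = curvature p.conn x + (t : ℂ) • extD X.alpha x := by
  have h1 : curvature (p.move X t).conn x =
      extD (fun y => connForm p.conn x y + (t : ℂ) • X.alpha y) x := by
    refine extD_congr ?_
    filter_upwards [(trivializationAt ℂ L x).open_baseSet.mem_nhds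
      (mem_baseSet_trivializationAt ℂ L x)] with y hy
    refine (connForm_addOneForm p.conn (fun y => t • X.alpha y) x hy).trans ?_
    ext v
    rfl
  rw [h1, extD_add (connForm_diffAt p.conn hp.conn x) ((hX.alpha.const_smul _).diffAt x),
    extD_const_smul _ (hX.alpha.diffAt x)]
  rfl

/-- The linearization of the curvature equation. -/
def curvatureLin (area : TwoForm M) (p : Config L) (X : Variation L) : TwoForm M := fun x =>
  extD X.alpha x - (Complex.I * (((inner ℂ (p.psi₁ x) (X.beta₁ x)).re +
    (inner ℂ (p.psi₂ x) (X.beta₂ x)).re : ℝ) : ℂ)) • area x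

/-- The linearization of the first Dirac equation. -/
def diracLin₁ (p : Config L) (X : Variation L) (x : M) (v : TangentSpace 𝓘(ℝ, ℂ) x) : L x :=
  delBar p.conn X.beta₁ x v + part01 (X.alpha x) v • p.psi₁ x
    - ((1 / 2 : ℂ) * part01 (X.gamma x) v) • p.psi₂ x
    - ((1 / 2 : ℂ) * part01 (p.phi x) v) • X.beta₂ x

/-- The linearization of the second Dirac equation. -/
def diracLin₂ (p : Config L) (X : Variation L) (x : M) (v : TangentSpace 𝓘(ℝ, ℂ) x) : L x :=
  delBar p.conn X.beta₂ x v + part01 (X.alpha x) v • p.psi₂ x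
    + ((1 / 2 : ℂ) * part01 (X.gamma x) v) • p.psi₁ x
    + ((1 / 2 : ℂ) * part01 (p.phi x) v) • X.beta₁ x

theorem delBar_move {p : Config L} {s s' : Sec L} (hs : s.IsSmooth) (hs' : s'.IsSmooth)
    (X : Variation L) (t : ℝ) (x : M) (v : TangentSpace 𝓘(ℝ, ℂ) x) :
    delBar (p.move X t).conn (fun y => s y + t • s' y) x v =
      delBar p.conn s x v + t • (delBar p.conn s' x v + part01 (X.alpha x) v • s x) +
        t ^ 2 • part01 (X.alpha x) v • s' x := by
  set w := tangentJ x v with hw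
  have h0 : ∀ u, (p.move X t).conn (fun y => s y + t • s' y) x u =
      p.conn s x u + t • p.conn s' x u + (t • X.alpha x u) • (s x + t • s' x) := by
    intro u
    have := congrArg (fun f : TangentSpace 𝓘(ℝ, ℂ) x →L[ℝ] L x => f u)
      (conn_add_smul p.conn hs hs' t x)
    exact congrArg (· + (t • X.alpha x u) • (s x + t • s' x)) this
  have h1 : delBar (p.move X t).conn (fun y => s y + t • s' y) x v =
    (1 / 2 : ℂ) • ((p.move X t).conn (fun y => s y + t • s' y) x v
      + Complex.I • (p.move X t).conn (fun y => s y + t • s' y) x w) := rfl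
  have h2 : ∀ r : Sec L, delBar p.conn r x v =
    (1 / 2 : ℂ) • (p.conn r x v + Complex.I • p.conn r x w) := fun _ => rfl
  have h3 : part01 (X.alpha x) v = (1 / 2 : ℂ) * (X.alpha x v + Complex.I * X.alpha x w) := rfl
  rw [h1, h2, h2, h3, h0, h0]
  simp only [← Complex.coe_smul, smul_eq_mul, Complex.ofReal_pow]
  module

/-- In each equation `a` is the defect at `p` and `c` collects the products of two components of
`X`; only the coefficient of `t` survives. -/
theorem mem_tangentSolution_iff (area : TwoForm M) {p : Config L} (hp : p.IsSmooth)
    (X : Variation L) : X ∈ tangentSolution area p ↔ X.IsSmooth ∧ ∀ x,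
      curvatureLin area p X x = 0 ∧ extD (fun y => part01 (X.gamma y)) x = 0 ∧
      (∀ v, diracLin₁ p X x v = 0) ∧ ∀ v, diracLin₂ p X x v = 0 := by
  refine and_congr_right fun hX => forall_congr' fun x => ?_
  refine and_congr ?_ (and_congr ?_ (and_congr ?_ ?_))
  · rw [ContinuousAlternatingMap.ext_iff]
    refine forall_congr' fun v => hasDerivAt_quadratic_iff (a := curvatureDefect area p x v)
      (c := -(Complex.I * (((‖X.beta₁ x‖ ^ 2 + ‖X.beta₂ x‖ ^ 2) / 2 : ℝ) : ℂ)) * area x v)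
      fun t => ?_
    have e1 : curvatureDefect area (p.move X t) x v = curvature (p.move X t).conn x v -
      (Complex.I * (((‖p.psi₁ x + t • X.beta₁ x‖ ^ 2 + ‖p.psi₂ x + t • X.beta₂ x‖ ^ 2) / 2 : ℝ) :
        ℂ)) * area x v := rfl
    have e2 : curvatureDefect area p x v = curvature p.conn x v -
      (Complex.I * (((‖p.psi₁ x‖ ^ 2 + ‖p.psi₂ x‖ ^ 2) / 2 : ℝ) : ℂ)) * area x v := rfl
    have e3 : curvatureLin area p X x v = extD X.alpha x v -
      (Complex.I * (((inner ℂ (p.psi₁ x) (X.beta₁ x)).re +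
        (inner ℂ (p.psi₂ x) (X.beta₂ x)).re : ℝ) : ℂ)) * area x v := rfl
    have e4 : curvature (p.move X t).conn x v =
        curvature p.conn x v + (t : ℂ) * extD X.alpha x v := by
      rw [curvature_move hp hX]; rfl
    rw [e1, e2, e3, e4, norm_add_smul_sq, norm_add_smul_sq]
    simp only [Complex.real_smul]
    push_cast
    ring
  · rw [ContinuousAlternatingMap.ext_iff]
    refine forall_congr' fun v => hasDerivAt_quadratic_iff (a := higgsDefect p x v)
      (c := 0) fun t => ?_
    have e1 : higgsDefect (p.move X t) x = higgsDefect p x +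
        (t : ℂ) • extD (fun y => part01 (X.gamma y)) x := by
      have e2 : higgsDefect (p.move X t) x =
          extD (fun y => part01 (p.phi y) + (t : ℂ) • part01 (X.gamma y)) x := by
        refine extD_congr (Filter.Eventually.of_forall fun y => ?_)
        ext v
        exact part01_add_smul_apply (p.phi y) (X.gamma y) t v
      rw [e2, extD_add (hp.phi.part01.diffAt x) ((hX.gamma.part01.const_smul _).diffAt x),
        extD_const_smul _ (hX.gamma.part01.diffAt x)]
      rfl
    rw [e1, smul_zero, add_zero]
    rfl
  · refine forall_congr' fun v => hasDerivAt_quadratic_iff (a := diracDefect₁ p x v)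
      (c := part01 (X.alpha x) v • X.beta₁ x -
        ((1 / 2 : ℂ) * part01 (X.gamma x) v) • X.beta₂ x) fun t => ?_
    have e1 : diracDefect₁ (p.move X t) x v =
      delBar (p.move X t).conn (fun y => p.psi₁ y + t • X.beta₁ y) x v +
        ((1 / 2 : ℂ) * -part01 (p.phi x + t • X.gamma x) v) • (p.psi₂ x + t • X.beta₂ x) := rfl
    have e2 : diracDefect₁ p x v = delBar p.conn p.psi₁ x v +
      ((1 / 2 : ℂ) * -part01 (p.phi x) v) • p.psi₂ x := rfl
    rw [e1, e2, delBar_move hp.psi₁ hX.beta₁, part01_add_smul_apply, diracLin₁]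
    simp only [← Complex.coe_smul, Complex.ofReal_pow]
    module
  · refine forall_congr' fun v => hasDerivAt_quadratic_iff (a := diracDefect₂ p x v)
      (c := part01 (X.alpha x) v • X.beta₂ x +
        ((1 / 2 : ℂ) * part01 (X.gamma x) v) • X.beta₁ x) fun t => ?_
    have e1 : diracDefect₂ (p.move X t) x v =
      -(((1 / 2 : ℂ) * -part01 (p.phi x + t • X.gamma x) v) • (p.psi₁ x + t • X.beta₁ x)) +
      delBar (p.move X t).conn (fun y => p.psi₂ y + t • X.beta₂ y) x v := rfl
    have e2 : diracDefect₂ p x v =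
      -(((1 / 2 : ℂ) * -part01 (p.phi x) v) • p.psi₁ x) + delBar p.conn p.psi₂ x v := rfl
    rw [e1, e2, delBar_move hp.psi₂ hX.beta₂, part01_add_smul_apply, diracLin₂]
    simp only [← Complex.coe_smul, Complex.ofReal_pow]
    module

/-- A unitary connection is complex linear, so `delBar` commutes with `i`; the terms in `α` and `γ`
pick up `i` through their `(0,1)` parts. -/
theorem diracLin₁_complexStructure {p : Config L} (hp : p.IsSmooth) {X : Variation L}
    (hX : X.IsSmooth) (x : M) (v : TangentSpace 𝓘(ℝ, ℂ) x) :
    diracLin₁ p (complexStructure X) x v = Complex.I • diracLin₁ p X x v := by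
  have e1 : diracLin₁ p (complexStructure X) x v =
    delBar p.conn (fun y => Complex.I • X.beta₁ y) x v + part01 (hodgeStar X.alpha x) v • p.psi₁ x
    - ((1 / 2 : ℂ) * part01 (hodgeStar X.gamma x) v) • p.psi₂ x
    - ((1 / 2 : ℂ) * part01 (p.phi x) v) • Complex.I • X.beta₂ x := rfl
  rw [e1, delBar_I_smul hp.unitary hX.beta₁, part01_hodgeStar, part01_hodgeStar, I_smul_apply,
    I_smul_apply, diracLin₁]
  module

theorem diracLin₂_complexStructure {p : Config L} (hp : p.IsSmooth) {X : Variation L}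
    (hX : X.IsSmooth) (x : M) (v : TangentSpace 𝓘(ℝ, ℂ) x) :
    diracLin₂ p (complexStructure X) x v = Complex.I • diracLin₂ p X x v := by
  have e1 : diracLin₂ p (complexStructure X) x v =
    delBar p.conn (fun y => Complex.I • X.beta₂ y) x v + part01 (hodgeStar X.alpha x) v • p.psi₂ x
    + ((1 / 2 : ℂ) * part01 (hodgeStar X.gamma x) v) • p.psi₁ x
    + ((1 / 2 : ℂ) * part01 (p.phi x) v) • Complex.I • X.beta₁ x := rfl
  rw [e1, delBar_I_smul hp.unitary hX.beta₂, part01_hodgeStar, part01_hodgeStar, I_smul_apply,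
    I_smul_apply, diracLin₂]
  module

theorem Variation.IsSmooth.complexStructure {X : Variation L} (hX : X.IsSmooth) :
    (complexStructure X).IsSmooth where
  alpha := hX.alpha.hodgeStar
  alpha_imaginary := hodgeStar_isImaginary hX.alpha_imaginary
  beta₁ := hX.beta₁.const_smul Complex.I
  beta₂ := hX.beta₂.const_smul Complex.I
  gamma := hX.gamma.hodgeStar
  gamma_imaginary := hodgeStar_isImaginary hX.gamma_imaginary

/-- The complex structure preserves all linearized equations except the curvature equation. -/
theorem complexStructure_mem_iff (area : TwoForm M) {p : Config L} (hp : p.IsSmooth)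
    {X : Variation L} (hX : X ∈ tangentSolution area p) :
    complexStructure X ∈ tangentSolution area p ↔
      ∀ x, curvatureLin area p (complexStructure X) x = 0 := by
  rw [mem_tangentSolution_iff area hp] at hX ⊢
  refine ⟨fun h x => (h.2 x).1, fun h => ⟨hX.1.complexStructure, fun x => ⟨h x, ?_, ?_, ?_⟩⟩⟩
  · have e1 : extD (fun y => part01 ((complexStructure X).gamma y)) x =
        extD (fun y => Complex.I • part01 (X.gamma y)) x :=
      extD_congr (Filter.Eventually.of_forall fun y => part01_hodgeStar X.gamma y)
    rw [e1, extD_const_smul _ (hX.1.gamma.part01.diffAt x), (hX.2 x).2.1]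
    exact smul_zero (A := ℂ [⋀^Fin 2]→L[ℝ] ℂ) Complex.I
  · intro v
    rw [diracLin₁_complexStructure hp hX.1, (hX.2 x).2.2.1, smul_zero]
  · intro v
    rw [diracLin₂_complexStructure hp hX.1, (hX.2 x).2.2.2, smul_zero]

end Sections

/-! ### The tangent space of the gauge orbit -/

section Orbit

theorem contMDiff_mul {M : Type*} [TopologicalSpace M] [ChartedSpace ℂ M] {f g : M → ℂ}
    (hf : ContMDiff 𝓘(ℝ, ℂ) 𝓘(ℝ, ℂ) ∞ f) (hg : ContMDiff 𝓘(ℝ, ℂ) 𝓘(ℝ, ℂ) ∞ g) :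
    ContMDiff 𝓘(ℝ, ℂ) 𝓘(ℝ, ℂ) ∞ (fun x => f x * g x) :=
  (contDiff_mul (𝕜 := ℝ) (𝔸 := ℂ)).comp_contMDiff (hf.prodMk_space hg)

variable {M : Type*} [TopologicalSpace M] [ChartedSpace ℂ M]
  {L : M → Type*} [∀ x, NormedAddCommGroup (L x)] [∀ x, InnerProductSpace ℂ (L x)]
  [TopologicalSpace (TotalSpace ℂ L)] [FiberBundle ℂ L] [VectorBundle ℂ ℂ L]

theorem unitFrame_ne_zero (x : M) : unitFrame L x x ≠ 0 := by
  intro h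
  have hx := mem_baseSet_trivializationAt ℂ L x
  have h1 := trivializationAt_unitFrame x hx
  rw [h, ← zero_smul ℂ (0 : L x), trivializationAt_snd_smul x hx, zero_mul] at h1
  exact zero_ne_one h1

/-- The infinitesimal gauge transformation `(dζ, -ζ Ψ, 0)` at `p`. -/
def infGauge (p : Config L) (ζ : M → ℂ) : Variation L where
  alpha := dOf ζ
  beta₁ := fun x => -ζ x • p.psi₁ x
  beta₂ := fun x => -ζ x • p.psi₂ x
  gamma := fun _ => 0

/-- The logarithmic derivative of `exp(tζ)` is `t dζ`, so the connection moves along a straight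
line. -/
theorem dOf_exp {ζ : M → ℂ} (hζ : ContMDiff 𝓘(ℝ, ℂ) 𝓘(ℝ, ℂ) ∞ ζ) (t : ℝ) (x : M)
    (v : TangentSpace 𝓘(ℝ, ℂ) x) :
    (Complex.exp (t * ζ x))⁻¹ * dOf (fun y => Complex.exp (t * ζ y)) x v = t * dOf ζ x v := by
  have hg : HasFDerivAt (fun w : ℂ => Complex.exp (t * w))
      ((ContinuousLinearMap.toSpanSingleton ℂ (Complex.exp (t * ζ x) * (t * 1))).restrictScalars ℝ)
      (ζ x) :=
    (((hasDerivAt_id (ζ x)).const_mul (t : ℂ)).cexp).hasFDerivAt.restrictScalars ℝ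
  have h1 := mfderiv_comp (I := 𝓘(ℝ, ℂ)) (I' := 𝓘(ℝ, ℂ)) (I'' := 𝓘(ℝ, ℂ)) x
    (g := fun w : ℂ => Complex.exp (t * w)) (f := ζ) hg.differentiableAt.mdifferentiableAt
    ((hζ x).mdifferentiableAt (by simp))
  rw [mfderiv_eq_fderiv, hg.fderiv] at h1
  have h2 : dOf (fun y => Complex.exp (t * ζ y)) x v =
      dOf ζ x v * (Complex.exp (t * ζ x) * (t * 1)) :=
    congrArg (fun f : ℂ →L[ℝ] ℂ => f v) h1
  rw [h2]
  field_simp [Complex.exp_ne_zero]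

theorem isVelocity_infGauge (p : Config L) {ζ : M → ℂ} (hζ : ContMDiff 𝓘(ℝ, ℂ) 𝓘(ℝ, ℂ) ∞ ζ) :
    IsVelocity (fun t : ℝ => gaugeAct (fun x => Complex.exp (t * ζ x)) p) (infGauge p ζ) := by
  have hexp : ∀ x, HasDerivAt (fun t : ℝ => (Complex.exp (t * ζ x))⁻¹) (-ζ x) 0 := by
    intro x
    have h1 : HasDerivAt (fun t : ℝ => Complex.exp (t * -ζ x))
        (Complex.exp (((0 : ℝ) : ℂ) * -ζ x) * (1 * -ζ x)) 0 :=
      ((Complex.ofRealCLM.hasDerivAt (x := (0 : ℝ))).mul_const (-ζ x)).cexp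
    have h2 : (fun t : ℝ => (Complex.exp (t * ζ x))⁻¹) = fun t : ℝ => Complex.exp (t * -ζ x) := by
      ext t
      rw [← Complex.exp_neg, mul_neg]
    rw [h2]
    simpa using h1
  refine ⟨fun s x v => ?_, fun x => (hexp x).smul_const _, fun x => (hexp x).smul_const _,
    fun x v => hasDerivAt_const (0 : ℝ) (p.phi x v)⟩
  refine hasDerivAt_quadratic (a := p.conn s x v) (c := 0) fun t => ?_
  have h1 : (gaugeAct (fun x => Complex.exp (t * ζ x)) p).conn s x v = p.conn s x v +
    ((Complex.exp (t * ζ x))⁻¹ * dOf (fun y => Complex.exp (t * ζ y)) x v) • s x := rfl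
  rw [h1, dOf_exp hζ, smul_zero, add_zero, mul_smul, Complex.coe_smul]
  rfl

/-- The form `α` is visible only through the products `α s`; evaluating on a frame that is nonzero
at `x` recovers it. -/
theorem IsVelocity.unique {c : ℝ → Config L} {X Y : Variation L} (hX : IsVelocity c X)
    (hY : IsVelocity c Y) : X = Y := by
  have h1 : X.alpha = Y.alpha := by
    ext x v
    exact smul_left_injective ℂ (unitFrame_ne_zero (L := L) x)
      ((hX.conn (unitFrame L x) x v).unique (hY.conn (unitFrame L x) x v))
  have h2 : X.beta₁ = Y.beta₁ := funext fun x => (hX.psi₁ x).unique (hY.psi₁ x)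
  have h3 : X.beta₂ = Y.beta₂ := funext fun x => (hX.psi₂ x).unique (hY.psi₂ x)
  have h4 : X.gamma = Y.gamma := by
    ext x v
    exact (hX.phi x v).unique (hY.phi x v)
  cases X
  cases Y
  simp_all

theorem mem_tangentOrbit_iff (p : Config L) (Y : Variation L) :
    Y ∈ tangentOrbit p ↔ ∃ ζ : M → ℂ, IsInfGauge ζ ∧ Y = infGauge p ζ := by
  refine exists_congr fun ζ => and_congr_right fun hζ => ⟨fun h => ?_, fun h => ?_⟩
  · exact h.unique (isVelocity_infGauge p hζ.smooth)
  · rw [h]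
    exact isVelocity_infGauge p hζ.smooth

end Orbit

/-! ### Orthogonality to the orbit as the linearized curvature equation -/

section Main

variable {M : Type*} [TopologicalSpace M] [ChartedSpace ℂ M] [IsManifold 𝓘(ℂ) ω M]

theorem wedge_comm (α β : OneForm M) (x : M) : wedge α β x = -wedge β α x := by
  refine twoForm_ext (τ' := fun y => -wedge β α y) ?_
  have h := fun a b : OneForm M => wedge_apply a b x ![(1 : ℂ), Complex.I]
  refine (h α β).trans (Eq.trans ?_ (congrArg (fun a : ℂ => -a) (h β α)).symm)
  ring

theorem wedge_zero (α : OneForm M) (x : M) : wedge α (fun _ => 0) x = 0 := by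
  refine twoForm_ext (τ' := fun _ => 0) ?_
  refine (wedge_apply α (fun _ => 0) x ![(1 : ℂ), Complex.I]).trans ?_
  have h0 : ∀ v : TangentSpace 𝓘(ℝ, ℂ) x, (0 : TangentSpace 𝓘(ℝ, ℂ) x →L[ℝ] ℂ) v = 0 :=
    fun _ => rfl
  rw [h0, h0, mul_zero, mul_zero, sub_zero]
  rfl

/-- Integration by parts on a compact Riemann surface. -/
theorem integral_wedge_dOf [T2Space M] [CompactSpace M] {α : OneForm M} (h : α.IsSmooth)
    {f : M → ℂ} (hf : ContMDiff 𝓘(ℝ, ℂ) 𝓘(ℝ, ℂ) ∞ f) :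
    integral (wedge α (dOf f)) = integral (fun x => f x • extD α x) := by
  have hs : OneForm.IsSmooth (fun y => (-f y) • α y) := h.smul hf.neg
  -- The Leibniz rule in the form `α ∧ df = f dα - d(fα)`; Stokes' theorem removes the exact term.
  have h1 : wedge α (dOf f) =
      fun x => f x • extD α x + extD (fun y => (-f y) • α y) x := by
    ext1 x
    have h2 : extD (fun y => (-f y) • α y) x = (-1 : ℂ) • extD (fun y => f y • α y) x := by
      rw [← extD_const_smul (-1) ((h.smul hf).diffAt x)]
      refine extD_congr (Filter.Eventually.of_forall fun y => ?_)
      ext v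
      exact (neg_mul (f y) (OneForm.coord α y v)).trans (neg_one_mul _).symm
    rw [h2, extD_smul hf h, wedge_comm]
    ext v
    have h3 : ∀ a b c : ℂ, -a = b * c + -1 * (a + b * c) := fun a b c => by ring
    exact h3 (wedge (dOf f) α x v) (f x) (extD α x v)
  rw [h1, integral_add (h.extD_densitySmooth.smul hf) hs.extD_densitySmooth, integral_extD hs,
    add_zero]

variable [T2Space M] [CompactSpace M]
  {L : M → Type*} [∀ x, NormedAddCommGroup (L x)] [∀ x, InnerProductSpace ℂ (L x)]
  [TopologicalSpace (TotalSpace ℂ L)] [FiberBundle ℂ L] [VectorBundle ℂ ℂ L]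
  [ContMDiffVectorBundle ∞ ℂ L 𝓘(ℝ, ℂ)] [IsSmoothHermitian L]

/-- The real part of the pairing of `Ψ` with `i β`. -/
def pairing (p : Config L) (X : Variation L) (x : M) : ℝ :=
  (inner ℂ (p.psi₁ x) (Complex.I • X.beta₁ x)).re +
    (inner ℂ (p.psi₂ x) (Complex.I • X.beta₂ x)).re

theorem pairing_contMDiff {p : Config L} (hp : p.IsSmooth) {X : Variation L} (hX : X.IsSmooth) :
    ContMDiff 𝓘(ℝ, ℂ) 𝓘(ℝ, ℂ) ∞ (fun x => (pairing p X x : ℂ)) := by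
  have h := (IsSmoothHermitian.smooth _ _ hp.psi₁ (hX.beta₁.const_smul Complex.I)).add
    (IsSmoothHermitian.smooth _ _ hp.psi₂ (hX.beta₂.const_smul Complex.I))
  refine ((Complex.ofRealCLM.comp Complex.reCLM).contMDiff.comp h).congr fun x => ?_
  simp [pairing]

theorem curvatureLin_complexStructure (area : TwoForm M) (p : Config L) (X : Variation L) (x : M) :
    curvatureLin area p (complexStructure X) x =
      extD (hodgeStar X.alpha) x + (-(Complex.I * pairing p X x)) • area x := by
  ext v
  have h1 : curvatureLin area p (complexStructure X) x v =
    extD (hodgeStar X.alpha) x v - (Complex.I * pairing p X x) * area x v := rfl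
  rw [h1, sub_eq_add_neg, ← neg_mul]
  rfl

theorem curvatureLin_densitySmooth {area : TwoForm M} (harea : IsAreaForm area) {p : Config L}
    (hp : p.IsSmooth) {X : Variation L} (hX : X.IsSmooth) :
    (curvatureLin area p (complexStructure X)).DensitySmooth := by
  rw [funext (curvatureLin_complexStructure area p X)]
  exact hX.alpha.hodgeStar.extD_densitySmooth.add (harea.smooth.densitySmooth.smul
    (contMDiff_mul (contMDiff_const (c := Complex.I)) (pairing_contMDiff hp hX)).neg)

/-- The linearized curvature equation after `I` is the formal adjoint of the infinitesimal gauge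
action. The connection term is integrated by parts, the spinor term agrees pointwise, and the Higgs
term vanishes because gauge transformations fix `Φ`. -/
theorem metric_infGauge {area : TwoForm M} (harea : IsAreaForm area) {p : Config L}
    (hp : p.IsSmooth) {X : Variation L} (hX : X.IsSmooth) {ζ : M → ℂ} (hζ : IsInfGauge ζ) :
    metric area X (infGauge p ζ) =
      (integral (fun x => ζ x • curvatureLin area p (complexStructure X) x)).re := by
  have hr : ∀ x, (inner ℂ (-ζ x • p.psi₁ x) (X.beta₁ x) +
      inner ℂ (-ζ x • p.psi₂ x) (X.beta₂ x) : ℂ).re = (ζ x * -(Complex.I * pairing p X x)).re := by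
    intro x
    simp only [inner_smul_left, inner_smul_right, pairing]
    simp [hζ.imaginary x]
    ring
  -- The right-hand side is a product of two imaginary numbers, so it is real and equals its real
  -- part.
  have hi : ∀ x, (((inner ℂ (-ζ x • p.psi₁ x) (X.beta₁ x) +
      inner ℂ (-ζ x • p.psi₂ x) (X.beta₂ x) : ℂ).re : ℝ) : ℂ) =
      ζ x * -(Complex.I * pairing p X x) := by
    intro x
    rw [hr]
    apply Complex.ext
    · simp
    · simp [hζ.imaginary x]
  have hs := (contMDiff_mul (contMDiff_const (c := Complex.I)) (pairing_contMDiff hp hX)).neg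
  have h1 : metric area X (infGauge p ζ) =
    (integral (wedge (hodgeStar X.alpha) (dOf ζ)) +
      integral (fun x => (((inner ℂ (-ζ x • p.psi₁ x) (X.beta₁ x) +
        inner ℂ (-ζ x • p.psi₂ x) (X.beta₂ x) : ℂ).re : ℝ) : ℂ) • area x) +
      integral (wedge (hodgeStar X.gamma) (fun _ => 0))).re := rfl
  rw [h1, integral_wedge_dOf hX.alpha.hodgeStar hζ.smooth, funext (wedge_zero _), integral_zero,
    add_zero]
  simp only [hi]
  rw [← integral_add (hX.alpha.hodgeStar.extD_densitySmooth.smul hζ.smooth)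
    (harea.smooth.densitySmooth.smul (contMDiff_mul hζ.smooth hs))]
  refine congrArg (fun τ : TwoForm M => (integral τ).re) (funext fun x => ?_)
  rw [curvatureLin_complexStructure]
  ext v
  have h2 : ∀ a b c d : ℂ, a * b + a * c * d = a * (b + c * d) := fun a b c d => by ring
  exact h2 (ζ x) (extD (hodgeStar X.alpha) x v) (-(Complex.I * pairing p X x)) (area x v)

/-- Since this form is imaginary, testing it against imaginary functions alone can detect it. -/
theorem curvatureLin_re {area : TwoForm M} (harea : IsAreaForm area) (p : Config L)
    {X : Variation L} (hX : X.IsSmooth) (x : M) :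
    (TwoForm.coord (curvatureLin area p (complexStructure X)) x ![1, Complex.I]).re = 0 := by
  have h1 : TwoForm.coord (curvatureLin area p (complexStructure X)) x ![1, Complex.I] =
    TwoForm.coord (extD (hodgeStar X.alpha)) x ![1, Complex.I] -
      (Complex.I * pairing p X x) * TwoForm.coord area x ![1, Complex.I] := rfl
  rw [h1, Complex.sub_re, extD_re_eq_zero hX.alpha.hodgeStar
    (hodgeStar_isImaginary hX.alpha_imaginary)]
  simp [harea.coord_im]

/-- An imaginary `2`-form that is orthogonal to all imaginary functions vanishes. -/
theorem eq_zero_of_integral_eq_zero {area : TwoForm M} (harea : IsAreaForm area) {τ : TwoForm M}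
    (hτ : τ.DensitySmooth) (hre : ∀ x, (TwoForm.coord τ x ![1, Complex.I]).re = 0)
    (h0 : ∀ ζ : M → ℂ, IsInfGauge ζ → (integral (fun x => ζ x • τ x)).re = 0) (x : M) :
    τ x = 0 := by
  -- The ratio of `τ` to `i area`, so that `τ = i h area`. The test function will be `ζ = -i h`, for
  -- which `ζ τ = h² area`.
  let h : M → ℝ := fun x => (TwoForm.coord τ x ![1, Complex.I]).im /
    (TwoForm.coord area x ![1, Complex.I]).re
  have hpos : ∀ x, 0 < (TwoForm.coord area x ![1, Complex.I]).re := fun x => by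
    simpa using harea.coord_re_pos x one_ne_zero
  have hτh : ∀ x, τ x = (Complex.I * h x) • area x := by
    intro x
    refine twoForm_ext (τ' := fun x => (Complex.I * h x) • area x) ?_
    have h1 : TwoForm.coord (fun x => (Complex.I * h x) • area x) x ![1, Complex.I] =
      (Complex.I * h x) * TwoForm.coord area x ![1, Complex.I] := rfl
    have h2 : h x * (TwoForm.coord area x ![1, Complex.I]).re =
      (TwoForm.coord τ x ![1, Complex.I]).im := div_mul_cancel₀ _ (hpos x).ne'
    rw [h1]
    apply Complex.ext
    · simp [hre, harea.coord_im]
    · simp [← h2]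
  have hsm : ContMDiff 𝓘(ℝ, ℂ) 𝓘(ℝ, ℂ) ∞ (fun x => -(Complex.I * h x)) := by
    refine contMDiff_of_comp_symm fun e he => ?_
    -- In every chart `i h` is the quotient of the densities of `τ` and `area`, the latter nowhere
    -- zero; hence `h` is smooth.
    have hne : ∀ z ∈ e.target, area.density e z ≠ 0 := fun z hz h' =>
      (harea.density_re_pos he hz).ne' (by rw [h', Complex.zero_re])
    refine (((hτ e he).mul ((harea.smooth.densitySmooth e he).inv hne)).neg).congr fun z hz => ?_
    have h1 : τ.density e z = (Complex.I * h (e.symm z)) * area.density e z := by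
      rw [funext hτh, TwoForm.density_smul]
    simp only [Function.comp, Pi.inv_apply, h1]
    field_simp [hne z hz]
  have hsm' : ContMDiff 𝓘(ℝ, ℂ) 𝓘(ℝ, ℂ) ∞ (fun x => ((h x ^ 2 : ℝ) : ℂ)) := by
    refine (contMDiff_mul hsm hsm).neg.congr fun x => ?_
    push_cast
    linear_combination (h x : ℂ) ^ 2 * Complex.I_sq
  have hint := h0 _ ⟨hsm, fun x => by simp⟩
  have h1 : (fun x => (-(Complex.I * h x)) • τ x) = fun x => ((h x ^ 2 : ℝ) : ℂ) • area x := by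
    ext1 x
    rw [hτh x]
    ext v
    have h2 : -(Complex.I * h x) * ((Complex.I * h x) * area x v) =
        ((h x ^ 2 : ℝ) : ℂ) * area x v := by
      push_cast
      linear_combination -(h x : ℂ) ^ 2 * area x v * Complex.I_sq
    exact h2
  rw [h1] at hint
  have h2 := integral_area_smul_eq_zero harea hsm' (fun x => sq_nonneg (h x)) hint x
  rw [hτh x, pow_eq_zero_iff (two_ne_zero) |>.1 h2, Complex.ofReal_zero, mul_zero]
  exact zero_smul ℂ (TwoForm.coord area x)

end Main

end ReducedSW

end

theorem lemma3p3 {M : Type*} [TopologicalSpace M] [T2Space M] [CompactSpace M] [ConnectedSpace M]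
    [ChartedSpace ℂ M] [IsManifold 𝓘(ℂ) ω M]
    {L : M → Type*} [∀ x, NormedAddCommGroup (L x)] [∀ x, InnerProductSpace ℂ (L x)]
    [TopologicalSpace (TotalSpace ℂ L)] [FiberBundle ℂ L] [VectorBundle ℂ ℂ L]
    [ContMDiffVectorBundle ∞ ℂ L 𝓘(ℝ, ℂ)] [ReducedSW.IsSmoothHermitian L]
    (area : ReducedSW.TwoForm M) (harea : ReducedSW.IsAreaForm area)
    (p : ReducedSW.Config L) (hp : p ∈ ReducedSW.solutionSpace area)
    (X : ReducedSW.Variation L) (hX : X ∈ ReducedSW.tangentSolution area p) :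
    ReducedSW.complexStructure X ∈ ReducedSW.tangentSolution area p ↔
      ∀ Y ∈ ReducedSW.tangentOrbit p, ReducedSW.metric area X Y = 0 := by
  have hps := hp.1
  have hXs := hX.1
  -- Only the curvature equation for `IX` is left; both directions now follow from
  -- `metric_infGauge`.
  rw [ReducedSW.complexStructure_mem_iff area hps hX]
  constructor
  · intro h Y hY
    obtain ⟨ζ, hζ, rfl⟩ := (ReducedSW.mem_tangentOrbit_iff p Y).1 hY
    rw [ReducedSW.metric_infGauge harea hps hXs hζ]
    have h1 : (fun x => ζ x • ReducedSW.curvatureLin area p (ReducedSW.complexStructure X) x) =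
        fun _ => 0 := by
      ext1 x
      rw [h x]
      exact smul_zero (A := ℂ [⋀^Fin 2]→L[ℝ] ℂ) (ζ x)
    rw [h1, ReducedSW.integral_zero, Complex.zero_re]
  · intro h
    refine ReducedSW.eq_zero_of_integral_eq_zero harea
      (ReducedSW.curvatureLin_densitySmooth harea hps hXs)
      (ReducedSW.curvatureLin_re harea p hXs) fun ζ hζ => ?_
    rw [← ReducedSW.metric_infGauge harea hps hXs hζ]
    exact h _ ((ReducedSW.mem_tangentOrbit_iff p _).2 ⟨ζ, hζ, rfl⟩)
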